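/- Let $p\in[0,1]$. For a finite field $\mathbb F_q$, the $q$-ary symmetric channel $W=q\text{-SC}_p$ outputs the input symbol with probability $1-p$ and each other symbol with probability $\frac p{q-1}$. Put $$W^0(y_1,y_2,u_2\mid u_1)=\tfrac1q\,W(y_1|u_1)W(y_2|u_1+u_2),\qquad W^1(y_1,y_2\mid u_2)=\tfrac1q\sum_{u_1\in\mathbb F_q}W(y_1|u_1)W(y_2|u_1+u_2),$$ and for $i\in\{0,1\}$ let $\pi_i=(\pi_i(\alpha))_{\alpha\in\mathbb F_q}$ be the vector of a posteriori probabilities of the input of $W^i$ given its output, for a uniformly distributed input, with $\|\pi_i\|^2=\sum_\alpha\pi_i(\alpha)^2$. The $(U\mid U+V)$-code of two linear codes $U,V\subseteq\mathbb F_q^n$ is $\{(u\mid u+v):u\in U,\ v\in V\}$. The Koetter–Vardy decoder of a Reed–Solomon code with evaluation points $x_1,\dots,x_n$ and dimension $k$ takes a reliability matrix $\Pi=(\Pi_j(\alpha))$ and a total multiplicity $s$. Starting from $m=0$, it increases $s$ times by one a multiplicity $m_{j,\alpha}$ for which $\Pi_j(\alpha)/(m_{j,\alpha}+1)$ is largest.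 It then takes a nonzero $Q(X,Y)$ of least $(1,k-1)$-weighted degree (weight $\max(k-1,0)$ on $Y$) that passes through each $(x_j,\alpha)$ with multiplicity at least $m_{j,\alpha}$. It lists all codewords $(f(x_j))_j$ with $\deg f<k$ and $Y-f(X)\mid Q$, and returns one on the list of largest score $\sum_j\Pi_j(c_j)$ (it fails if the list is empty). The $(U\mid U+V)$-decoder, having received $(y_1\mid y_2)$, first decodes $V$ to a word $v$, using the a posteriori probabilities for $W^1$ at the outputs $(y_1(j),y_2(j))$. It then decodes $U$ to a word $u$, using those for $W^0$ at the outputs $(y_1(j),y_2(j),v(j))$, and returns $(u\mid u+v)$. Then, as $q\to\infty$ over the prime powers, with $p$ fixed, $$\mathbb E\|\pi_0\|^2=\frac{(p+2)(p-1)^2}{2-p}+O\!\left(\tfrac1q\right),\qquad \mathbb E\|\pi_1\|^2=(1-p)^4+O\!\left(\tfrac1q\right).$$ Moreover, for every real $$R<\frac{(p^3-4p^2+4p-4)(1-p)^2}{2(p-2)}$$ there is an infinite sequence of $(U\mid U+V)$-codes of rate $\ge R$, whose components $U$ and $V$ are Reed–Solomon codes (of positive dimension if $p<1$; for $p=1$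 the zero code is admitted), whose length and alphabet size $q$ are strictly increasing, such that, for suitable total multiplicities, the probability of error on the $q\text{-SC}_p$ under the $(U\mid U+V)$-decoder based on Koetter–Vardy decoding, maximized over the transmitted codewords, tends to $0$. -/

import Mathlib

open Filter Topology Polynomial

noncomputable section

/-! ### Codes -/

/-- The Reed-Solomon code with evaluation points `x` and dimension `k`: all evaluation vectors of
polynomials of degree `< k` (one takes `x` injective and `k` at most the length). -/
def rsCode {F ι : Type} [Field F] (x : ι → F) (k : ℕ) : Submodule F (ι → F) :=
  (degreeLT F k).map (LinearMap.pi fun i => leval (x i))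

/-- The code `(U | U + V)`; the two halves of a word are indexed by the two copies of `ι`. -/
def uvCode {F ι : Type} [Field F] (U V : Submodule F (ι → F)) : Submodule F (ι ⊕ ι → F) where
  carrier := {w | ∃ u ∈ U, ∃ v ∈ V, w = Sum.elim u (u + v)}
  zero_mem' := ⟨0, U.zero_mem, 0, V.zero_mem, by ext (i | i) <;> simp⟩
  add_mem' := by
    rintro _ _ ⟨u, hu, v, hv, rfl⟩ ⟨u', hu', v', hv', rfl⟩
    refine ⟨u + u', U.add_mem hu hu', v + v', V.add_mem hv hv', ?_⟩
    ext (i | i)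
    · simp
    · simp only [Pi.add_apply, Sum.elim_inr]
      ring
  smul_mem' := by
    rintro a _ ⟨u, hu, v, hv, rfl⟩
    refine ⟨a • u, U.smul_mem a hu, a • v, V.smul_mem a hv, ?_⟩
    ext (i | i) <;> simp [mul_add]

/-- The rate (dimension over length) of a linear code. -/
def codeRate {F κ : Type} [Field F] [Fintype κ] (C : Submodule F (κ → F)) : ℝ :=
  (Module.finrank F C : ℝ) / (Fintype.card κ : ℝ)

/-! ### Memoryless channels; `W a y` is the probability of receiving `y` when `a` is sent -/

open Classical in
/-- The `q`-ary symmetric channel of crossover probability `p`, where `q = |F|`. -/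
def qSC (F : Type) [Fintype F] (p : ℝ) : F → F → ℝ := fun a y =>
  if y = a then 1 - p else p / ((Fintype.card F : ℝ) - 1)

/-- The channel `W⁰` seen by the decoder of `U`; its output is `(y₁, y₂, u₂)`. -/
def channelU {F Y : Type} [Field F] [Fintype F] (W : F → Y → ℝ) : F → Y × Y × F → ℝ :=
  fun u₁ y => (1 / (Fintype.card F : ℝ)) * (W u₁ y.1 * W (u₁ + y.2.2) y.2.1)

/-- The channel `W¹` seen by the decoder of `V`; its output is `(y₁, y₂)`. -/
def channelV {F Y : Type} [Field F] [Fintype F] (W : F → Y → ℝ) : F → Y × Y → ℝ :=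
  fun u₂ y => (1 / (Fintype.card F : ℝ)) * ∑ u₁ : F, W u₁ y.1 * W (u₁ + u₂) y.2

/-- The a posteriori probability that `α` was sent, given that `y` was received and that the
channel input is uniformly distributed. -/
def app {F Y : Type} [Fintype F] (W : F → Y → ℝ) (y : Y) (α : F) : ℝ :=
  W α y / ∑ β : F, W β y

/-- The Koetter-Vardy capacity `𝔼 ‖π‖²`, for a uniformly distributed channel input. -/
def kvCapacity {F Y : Type} [Fintype F] [Fintype Y] (W : F → Y → ℝ) : ℝ :=
  (1 / (Fintype.card F : ℝ)) * ∑ x : F, ∑ y : Y, W x y * ∑ α : F, app W y α ^ 2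

/-! ### The Koetter-Vardy decoder

A reliability matrix `P` has one column `P i : F → ℝ` for each code position `i`. -/

/-- The score `⟨P, ⌊c⌋⟩` of a word. -/
def score {F ι : Type} [Fintype ι] (P : ι → F → ℝ) (c : ι → F) : ℝ := ∑ i, P i (c i)

open Classical in
/-- The multiplicity matrix of total multiplicity `s`, computed greedily from `P`: `s` times, a
position `a` at which `P a / (m a + 1)` is largest has its multiplicity `m a` increased by one. -/
def multMatrix {F ι : Type} (P : ι → F → ℝ) : ℕ → ι × F → ℕ
  | 0 => fun _ => 0
  | s + 1 =>
    let m := multMatrix P s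
    if h : ∃ a : ι × F, ∀ b : ι × F,
        P b.1 b.2 / ((m b : ℝ) + 1) ≤ P a.1 a.2 / ((m a : ℝ) + 1) then
      Function.update m h.choose (m h.choose + 1)
    else m

/-- `Q(X, Y)`, a polynomial in `Y` over `F[X]`, passes through the point `(a, b)` with multiplicity
at least `m`: `Q(X + a, Y + b)` has no monomial of total degree `< m`. -/
def PassesThrough {F : Type} [Field F] (Q : F[X][X]) (a b : F) (m : ℕ) : Prop :=
  ∀ i j : ℕ, i + j < m → (taylor a ((taylor (C b) Q).coeff j)).coeff i = 0

/-- The `(1, w)`-weighted degree of `Q(X, Y)`. -/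
def weightedDeg {F : Type} [Field F] (w : ℕ) (Q : F[X][X]) : ℕ :=
  Q.support.sup fun j => (Q.coeff j).natDegree + w * j

/-- `Q` is a nonzero polynomial that passes through all points `(x i, α)` with multiplicity at
least `m (i, α)`, and it has minimal `(1, k - 1)`-weighted degree among all of these. -/
def IsInterpolation {F ι : Type} [Field F] (x : ι → F) (k : ℕ) (m : ι × F → ℕ) (Q : F[X][X]) :
    Prop :=
  (Q ≠ 0 ∧ ∀ i α, PassesThrough Q (x i) α (m (i, α))) ∧
    ∀ Q' : F[X][X], Q' ≠ 0 → (∀ i α, PassesThrough Q' (x i) α (m (i, α))) →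
      weightedDeg (k - 1) Q ≤ weightedDeg (k - 1) Q'

/-- The list of codewords produced by the Koetter-Vardy algorithm with total multiplicity `s`:
the evaluation vectors of all `f` with `deg f < k` such that `Y - f(X)` divides the interpolation
polynomial (an arbitrary one, if there are several). -/
def kvList {F ι : Type} [Field F] (x : ι → F) (k s : ℕ) (P : ι → F → ℝ) : Set (ι → F) :=
  {c | ∃ f : F[X], f.degree < (k : WithBot ℕ) ∧
    (X - C f) ∣ Classical.epsilon (IsInterpolation x k (multMatrix P s)) ∧
    c = fun i => f.eval (x i)}

open Classical in
/-- The Koetter-Vardy decoder: a codeword on the list with the largest score; it fails (`none`)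
if the list is empty. -/
def kvDecode {F ι : Type} [Field F] [Fintype ι] (x : ι → F) (k s : ℕ) (P : ι → F → ℝ) :
    Option (ι → F) :=
  if h : ∃ c ∈ kvList x k s P, ∀ c' ∈ kvList x k s P, score P c' ≤ score P c then
    some h.choose
  else none

/-! ### The `(U | U + V)` decoder -/

/-- First `V` is decoded with the Koetter-Vardy decoder from the a posteriori probabilities of the
symbols `v i` given `(y₁ i, y₂ i)`; then `U` is decoded with the Koetter-Vardy decoder from the
a posteriori probabilities of the symbols `u i` given `(y₁ i, y₂ i, v i)`, where `v` is the word
just found. Here `U` and `V` are the Reed-Solomon codes of dimensions `k₀` and `k₁` on the points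
`x`, and `s₀` and `s₁` are the total multiplicities used by the two decoders. -/
def uvDecode {F Y ι : Type} [Field F] [Fintype F] [Fintype ι] (W : F → Y → ℝ) (x : ι → F)
    (k₀ k₁ s₀ s₁ : ℕ) (y : ι ⊕ ι → Y) : Option (ι ⊕ ι → F) :=
  (kvDecode x k₁ s₁ fun i => app (channelV W) (y (Sum.inl i), y (Sum.inr i))).bind fun v =>
    (kvDecode x k₀ s₀ fun i => app (channelU W) (y (Sum.inl i), y (Sum.inr i), v i)).map fun u =>
      Sum.elim u (u + v)

open Classical in
/-- The probability that the decoder `dec` does not return `c` when `c` is sent. -/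
def errorProb {F Y κ : Type} [Fintype Y] [Fintype κ] (W : F → Y → ℝ)
    (dec : (κ → Y) → Option (κ → F)) (c : κ → F) : ℝ :=
  ∑ y : κ → Y, if dec y = some c then 0 else ∏ j, W (c j) (y j)

/-- The largest error probability over all codewords of the code. -/
def maxErrorProb {F Y κ : Type} [Field F] [Fintype Y] [Fintype κ] (W : F → Y → ℝ)
    (C : Submodule F (κ → F)) (dec : (κ → Y) → Option (κ → F)) : ℝ :=
  ⨆ c : C, errorProb W dec c

end

/-! ### Interpolation polynomials -/

/-! For either channel, the posterior probability of the transmitted symbol and the squared norm of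
the posterior vector have the same mean κ. Over n independent positions the score of the sent word
and ‖Π‖² therefore both concentrate near κn. For a large total multiplicity the Koetter–Vardy list
contains a codeword as soon as (k - 1)‖Π‖² < score² (`eventually_mem_kvList`), which here means
roughly k < κn. Dimensions slightly below κ₀n and κ₁n give rates close to (κ₀ + κ₁)/2, and the limit
of this quantity is the stated bound.

The list criterion combines two facts. Counting coefficients against conditions gives an
interpolation polynomial Q of small weighted degree, and Q(X, f(X)) then has more zeros than its
degree allows (`mem_kvList_of_cost`). The greedy rule makes the multiplicities proportional to Π up
to bounded errors (`mul_multMatrix_le`).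

The sent word must also have the strictly largest score. Apart from at most two candidates per
position, read off from the noise, every symbol has posterior O(1/q). A rival with as large a score
must then follow candidates in at least k + L positions, with L about δn. A fixed wrong symbol is a
candidate with probability O(1/q), and codewords are determined by k coordinates, so a union bound
gives 12^n (2/(q - 1))^L (`prodProb_agreement_le`). With n = q this tends to 0 superexponentially.
Together with Chernoff bounds for the score and the norm this yields
`eventually_prodProb_kvDecode_le`.

By translation invariance the posteriors depend only on the noise, shifted by the sent symbols. If V
is decoded correctly, U is decoded with exactly the posteriors of W⁰, so the error probabilities of
the two decoders add up. The capacities are explicit finite sums, because the difference of two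
noise symbols has only two distinct probabilities: one at zero and one elsewhere. For p = 1 both
limiting capacities vanish and the zero code is used. -/

theorem X_sub_C_pow_dvd_of_coeff_taylor {F : Type} [Field F] (a : F) (n : ℕ) (g : F[X])
    (h : ∀ i < n, (taylor a g).coeff i = 0) : (X - C a) ^ n ∣ g := by
  obtain ⟨r, hr⟩ := X_pow_dvd_iff.2 h
  refine ⟨taylor (-a) r, ?_⟩
  have := congrArg (taylor (-a)) hr
  rwa [taylor_taylor, neg_add_cancel, taylor_zero, taylor_mul, taylor_pow, taylor_X, C_neg,
    ← sub_eq_add_neg] at this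

/-- Expand Q(X, f) in powers of f - b. In the term of degree j the power (f - b)^j supplies (X -
a)^j, and the vanishing conditions supply the missing (X - a)^(m - j). -/
theorem PassesThrough.pow_dvd_eval {F : Type} [Field F] {Q : F[X][X]} {a b : F} {m : ℕ}
    (h : PassesThrough Q a b m) {f : F[X]} (hf : f.eval a = b) : (X - C a) ^ m ∣ Q.eval f := by
  have hq : Q.eval f = (taylor (C b) Q).eval (f - C b) := by rw [taylor_eval, sub_add_cancel]
  rw [hq, eval_eq_sum_range]
  refine Finset.dvd_sum fun j _ => ?_
  have h1 : (X - C a) ∣ f - C b := by rw [dvd_iff_isRoot]; simp [hf]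
  have h2 : (X - C a) ^ (m - j) ∣ (taylor (C b) Q).coeff j :=
    X_sub_C_pow_dvd_of_coeff_taylor _ _ _ fun i hi => h i j (by omega)
  calc (X - C a) ^ m ∣ (X - C a) ^ ((m - j) + j) := pow_dvd_pow _ (by omega)
    _ = (X - C a) ^ (m - j) * (X - C a) ^ j := pow_add _ _ _
    _ ∣ _ := mul_dvd_mul h2 (pow_dvd_pow_of_dvd h1 j)

theorem natDegree_eval_le_weightedDeg {F : Type} [Field F] (Q : F[X][X]) {f : F[X]} {w : ℕ}
    (hf : f.natDegree ≤ w) : (Q.eval f).natDegree ≤ weightedDeg w Q := by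
  rw [eval_eq_sum, Polynomial.sum]
  refine natDegree_sum_le_of_forall_le _ _ fun j hj => ?_
  calc (Q.coeff j * f ^ j).natDegree ≤ (Q.coeff j).natDegree + (f ^ j).natDegree := natDegree_mul_le
    _ ≤ (Q.coeff j).natDegree + j * f.natDegree := by gcongr; exact natDegree_pow_le
    _ ≤ (Q.coeff j).natDegree + w * j := by rw [mul_comm w]; gcongr
    _ ≤ _ := Finset.le_sup (f := fun j => (Q.coeff j).natDegree + w * j) hj

/-- Q(X, f(X)) is divisible by the coprime powers (X - x i)^m, whose total degree exceeds the
weighted degree of Q, so it must vanish. -/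
theorem X_sub_C_dvd_of_weightedDeg_lt {F ι : Type} [Field F] [Fintype ι] {x : ι → F}
    (hx : Function.Injective x) {k : ℕ} {m : ι × F → ℕ} {Q : F[X][X]}
    (hQ : ∀ i α, PassesThrough Q (x i) α (m (i, α))) {f : F[X]}
    (hf : f.degree < (k : WithBot ℕ))
    (h : weightedDeg (k - 1) Q < ∑ i, m (i, f.eval (x i))) : (X - C f) ∣ Q := by
  rw [dvd_iff_isRoot, IsRoot]
  by_contra hne
  -- The subtraction truncates: for k = 0 only f = 0 is possible, and its `natDegree` is 0.
  have hfk : f.natDegree ≤ k - 1 := by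
    by_cases h0 : f = 0
    · simp [h0]
    · have := (natDegree_lt_iff_degree_lt h0).2 hf
      omega
  have hdvd : ∏ i, (X - C (x i)) ^ m (i, f.eval (x i)) ∣ Q.eval f :=
    Finset.prod_dvd_of_coprime
      (fun i _ j _ hij => (pairwise_coprime_X_sub_C hx hij).pow)
      (fun i _ => (hQ i _).pow_dvd_eval rfl)
  have h1 := natDegree_le_of_dvd hdvd hne
  rw [natDegree_prod_of_monic _ _ (fun i _ => (monic_X_sub_C _).pow _)] at h1
  simp only [natDegree_pow, natDegree_X_sub_C, mul_one] at h1
  have h2 := natDegree_eval_le_weightedDeg Q hfk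
  omega

theorem sum_range_sub_mul_two (m : ℕ) : (∑ a ∈ Finset.range m, (m - a)) * 2 = m * (m + 1) := by
  induction m with
  | zero => simp
  | succ m ih =>
    rw [Finset.sum_range_succ']
    simp only [Nat.add_sub_add_right, Nat.sub_zero]
    rw [add_mul, ih]
    ring

theorem sum_range_sub_mul_add (S w J : ℕ) (h : w * J ≤ S) :
    (∑ j ∈ Finset.range (J + 1), (S - w * j)) * 2 + w * J * (J + 1) = 2 * S * (J + 1) := by
  induction J with
  | zero => simp [mul_comm]
  | succ J ih =>
    have h' : w * J ≤ S := le_trans (Nat.mul_le_mul_left _ (Nat.le_succ J)) h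
    rw [Finset.sum_range_succ, add_mul]
    have := ih h'
    zify [h, h'] at this ⊢
    linear_combination this

theorem finrank_degreeLT {F : Type} [Field F] (n : ℕ) : Module.finrank F (degreeLT F n) = n := by
  rw [(degreeLTEquiv F n).finrank_eq]; simp

/-- The polynomial in `Y` with the given coefficients. -/
noncomputable def bivariate {F : Type} [Field F] {J : ℕ} {d : ℕ → ℕ}
    (g : (j : Fin (J + 1)) → degreeLT F (d j)) : F[X][X] :=
  ∑ j : Fin (J + 1), monomial (j : ℕ) (g j : F[X])

theorem bivariate_coeff {F : Type} [Field F] {J : ℕ} {d : ℕ → ℕ}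
    (g : (j : Fin (J + 1)) → degreeLT F (d j)) (l : Fin (J + 1)) :
    (bivariate g).coeff l = g l := by
  classical
  simp only [bivariate, finsetSum_coeff, coeff_monomial, Fin.val_inj]
  simp

theorem bivariate_coeff_of_lt {F : Type} [Field F] {J : ℕ} {d : ℕ → ℕ}
    (g : (j : Fin (J + 1)) → degreeLT F (d j)) (l : ℕ) (hl : J < l) :
    (bivariate g).coeff l = 0 := by
  simp only [bivariate, finsetSum_coeff, coeff_monomial]
  exact Finset.sum_eq_zero fun j _ => if_neg (by have := j.2; omega)

theorem bivariate_add {F : Type} [Field F] {J : ℕ} {d : ℕ → ℕ}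
    (g g' : (j : Fin (J + 1)) → degreeLT F (d j)) :
    bivariate (g + g') = bivariate g + bivariate g' := by
  simp [bivariate, Finset.sum_add_distrib]

theorem bivariate_smul {F : Type} [Field F] {J : ℕ} {d : ℕ → ℕ} (r : F)
    (g : (j : Fin (J + 1)) → degreeLT F (d j)) :
    bivariate (r • g) = (C r : F[X]) • bivariate g := by
  simp [bivariate, Finset.smul_sum, smul_eq_C_mul]

/-- Linear algebra: the coefficient of Y^j ranges over polynomials of degree below S - wj, and a
point of multiplicity m imposes m(m + 1)/2 linear conditions. The hypothesis, which is twice this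
count, says that there are more unknowns than conditions. -/
theorem exists_passesThrough_aux {F ι : Type} [Field F] [Fintype F] [Fintype ι] (x : ι → F)
    (m : ι × F → ℕ) {w S J : ℕ} (hJ : w * J < S)
    (h : ∑ a, m a * (m a + 1) + w * J * (J + 1) < 2 * S * (J + 1)) :
    ∃ Q : F[X][X], Q ≠ 0 ∧ (∀ i α, PassesThrough Q (x i) α (m (i, α))) ∧
      weightedDeg w Q < S := by
  let d : ℕ → ℕ := fun j => S - w * j
  let V := (j : Fin (J + 1)) → degreeLT F (d j)
  let K := Σ pt : ι × F, Σ a : Fin (m pt), Fin (m pt - a)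
  let L : V →ₗ[F] (K → F) :=
    { toFun := fun g c =>
        (taylor (x c.1.1) ((taylor (C c.1.2) (bivariate g)).coeff c.2.1)).coeff c.2.2
      map_add' := fun g g' => by
        have := bivariate_add g g'
        funext c
        simp [this]
      map_smul' := fun r g => by
        have := bivariate_smul r g
        funext c
        simp only [this, map_smul, coeff_smul, smul_eq_mul, taylor_mul, taylor_C, coeff_C_mul,
          RingHom.id_apply, Pi.smul_apply] }
  have hV : Module.finrank F V * 2 + w * J * (J + 1) = 2 * S * (J + 1) := by
    rw [Module.finrank_pi_fintype, ← sum_range_sub_mul_add S w J hJ.le]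
    simp only [finrank_degreeLT]
    rw [Fin.sum_univ_eq_sum_range d]
  have hK : Fintype.card K * 2 = ∑ a, m a * (m a + 1) := by
    simp only [K, Fintype.card_sigma, Fintype.card_fin]
    rw [Finset.sum_mul]
    refine Finset.sum_congr rfl fun a _ => ?_
    rw [Fin.sum_univ_eq_sum_range (fun b => m a - b), sum_range_sub_mul_two]
  have hlt : Module.finrank F (K → F) < Module.finrank F V := by
    rw [Module.finrank_fintype_fun_eq_card]
    omega
  obtain ⟨g, hg, hg0⟩ := (Submodule.ne_bot_iff _).1 (LinearMap.ker_ne_bot_of_finrank_lt (f := L) hlt)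
  rw [LinearMap.mem_ker] at hg
  have hd : ∀ l : Fin (J + 1), g l ≠ 0 → ((g l : F[X])).natDegree < S - w * l := fun l hl => by
    have := mem_degreeLT.1 (g l).2
    exact (natDegree_lt_iff_degree_lt (by simpa using hl)).2 this
  refine ⟨bivariate g, ?_, ?_, ?_⟩
  · intro h0
    apply hg0
    funext l
    apply Subtype.ext
    rw [← bivariate_coeff g l, h0]
    rfl
  · intro i α a b hab
    exact congrFun hg ⟨(i, α), ⟨b, by omega⟩, ⟨a, by dsimp only; omega⟩⟩
  · rw [weightedDeg, Finset.sup_lt_iff (by rw [bot_eq_zero']; omega)]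
    intro j hj
    rw [mem_support_iff] at hj
    have hjJ : j < J + 1 := by
      by_contra hc
      exact hj (bivariate_coeff_of_lt g j (by omega))
    have h1 := bivariate_coeff g ⟨j, hjJ⟩
    simp only at h1
    rw [h1] at hj ⊢
    have := hd ⟨j, hjJ⟩ (by simpa using hj)
    simp only at this
    omega

theorem exists_passesThrough {F ι : Type} [Field F] [Fintype F] [Fintype ι] (x : ι → F)
    (m : ι × F → ℕ) {w S : ℕ} (hS : 0 < S) (h : w * ∑ a, m a * (m a + 1) < S ^ 2) :
    ∃ Q : F[X][X], Q ≠ 0 ∧ (∀ i α, PassesThrough Q (x i) α (m (i, α))) ∧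
      weightedDeg w Q < S := by
  set c := ∑ a, m a * (m a + 1) with hc
  rcases Nat.eq_zero_or_pos w with rfl | hw
  -- For w = 0 powers of Y cost nothing, so taking c + 1 of them already outnumbers the c/2
  -- conditions.
  · refine exists_passesThrough_aux x m (J := c) (by omega) ?_
    rw [← hc]
    nlinarith
  · have h1 := Nat.div_add_mod (S - 1) w
    have h2 := Nat.mod_lt (S - 1) hw
    -- The largest J with wJ < S. Then w(J + 1) ≥ S and 2S - wJ ≥ S, so w times twice the number of
    -- unknowns is at least S².
    set J := (S - 1) / w
    refine exists_passesThrough_aux x m (J := J) (by omega) ?_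
    rw [← hc]
    have h3 : S ≤ w * (J + 1) := by rw [mul_add]; omega
    have h4 : w * J < S := by omega
    refine lt_of_mul_lt_mul_left (a := w) ?_ (Nat.zero_le _)
    have h5 : w * J * (w * (J + 1)) + S * S ≤ S * (w * (J + 1)) + S * (w * (J + 1)) :=
      add_le_add (Nat.mul_le_mul_right _ h4.le) (Nat.mul_le_mul_left _ h3)
    nlinarith

/-- Weighted degrees are natural numbers, so a minimal polynomial exists and the arbitrary choice
made by the decoder is a genuine interpolation polynomial. -/
theorem isInterpolation_epsilon {F ι : Type} [Field F] [Fintype F] [Fintype ι] (x : ι → F) (k : ℕ)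
    (m : ι × F → ℕ) {Q : F[X][X]} (hQ : Q ≠ 0)
    (hQm : ∀ i α, PassesThrough Q (x i) α (m (i, α))) :
    IsInterpolation x k m (Classical.epsilon (IsInterpolation x k m)) := by
  apply Classical.epsilon_spec (p := IsInterpolation x k m)
  let s : Set F[X][X] := {Q | Q ≠ 0 ∧ ∀ i α, PassesThrough Q (x i) α (m (i, α))}
  have hs : s.Nonempty := ⟨Q, hQ, hQm⟩
  refine ⟨Function.argminOn (weightedDeg (k - 1)) s hs, Function.argminOn_mem _ s hs, ?_⟩
  intro Q' h0 h1
  exact Function.argminOn_le (weightedDeg (k - 1)) s (show Q' ∈ s from ⟨h0, h1⟩)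

/-- The cost condition provides one interpolating Q of weighted degree below the total multiplicity
along the codeword; by minimality the decoder's polynomial is no worse. -/
theorem mem_kvList_of_cost {F ι : Type} [Field F] [Fintype F] [Fintype ι] {x : ι → F}
    (hx : Function.Injective x) {k s : ℕ} {P : ι → F → ℝ} {f : F[X]}
    (hf : f.degree < (k : WithBot ℕ))
    (h0 : 0 < ∑ i, multMatrix P s (i, f.eval (x i)))
    (h : (k - 1) * ∑ a, multMatrix P s a * (multMatrix P s a + 1) <
      (∑ i, multMatrix P s (i, f.eval (x i))) ^ 2) :
    (fun i => f.eval (x i)) ∈ kvList x k s P := by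
  obtain ⟨Q, hQ, hQm, hd⟩ := exists_passesThrough x (multMatrix P s) h0 h
  have hI := isInterpolation_epsilon x k (multMatrix P s) hQ hQm
  exact ⟨f, hf, X_sub_C_dvd_of_weightedDeg_lt hx hI.1.2 hf ((hI.2 Q hQ hQm).trans_lt hd), rfl⟩

/-! ### Greedy multiplicities -/

open Classical in
theorem multMatrix_succ {F ι : Type} [Finite F] [Finite ι] [Nonempty (ι × F)] (P : ι → F → ℝ)
    (s : ℕ) : ∃ a : ι × F, (∀ b : ι × F, P b.1 b.2 / ((multMatrix P s b : ℝ) + 1) ≤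
      P a.1 a.2 / ((multMatrix P s a : ℝ) + 1)) ∧
      multMatrix P (s + 1) a = multMatrix P s a + 1 ∧
      ∀ b, b ≠ a → multMatrix P (s + 1) b = multMatrix P s b := by
  have h := Finite.exists_max (fun b : ι × F => P b.1 b.2 / ((multMatrix P s b : ℝ) + 1))
  refine ⟨h.choose, h.choose_spec, ?_, ?_⟩
  · simp only [multMatrix]
    rw [dif_pos h]
    exact Function.update_self _ _ _
  · intro b hb
    simp only [multMatrix]
    rw [dif_pos h]
    exact Function.update_of_ne hb _ _

theorem sum_multMatrix {F ι : Type} [Fintype F] [Fintype ι] [Nonempty (ι × F)] (P : ι → F → ℝ)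
    (s : ℕ) : ∑ a, multMatrix P s a = s := by
  classical
  induction s with
  | zero => simp [multMatrix]
  | succ s ih =>
    obtain ⟨a, -, h1, h2⟩ := multMatrix_succ P s
    rw [← Finset.add_sum_erase _ _ (Finset.mem_univ a)] at ih ⊢
    rw [h1, Finset.sum_congr rfl fun b hb => h2 b (Finset.ne_of_mem_erase hb),
      add_right_comm, ih]

/-- The greedy invariant m_a / P_a ≤ (m_b + 1) / P_b in denominator-free form. When a is
incremented, this is precisely the maximality that selected a; otherwise the right-hand side can
only grow. -/
theorem mul_multMatrix_le {F ι : Type} [Fintype F] [Fintype ι] [Nonempty (ι × F)]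
    {P : ι → F → ℝ} (hP : ∀ i α, 0 ≤ P i α) (s : ℕ) (a b : ι × F) :
    P b.1 b.2 * multMatrix P s a ≤ P a.1 a.2 * (multMatrix P s b + 1) := by
  induction s generalizing a b with
  | zero => simpa [multMatrix] using hP _ _
  | succ s ih =>
    obtain ⟨c, h0, h1, h2⟩ := multMatrix_succ P s
    have hmono : multMatrix P s b ≤ multMatrix P (s + 1) b := by
      by_cases hb : b = c
      · rw [hb, h1]; omega
      · rw [h2 b hb]
    have hmono' : (multMatrix P s b : ℝ) ≤ multMatrix P (s + 1) b := by exact_mod_cast hmono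
    by_cases ha : a = c
    · subst ha
      have := h0 b
      rw [div_le_div_iff₀ (by positivity) (by positivity)] at this
      rw [h1]
      push_cast
      exact this.trans (by gcongr; exact hP _ _)
    · rw [h2 a ha]
      exact (ih a b).trans (by gcongr; exact hP _ _)

theorem eventually_quadratic_pos {A : ℝ} (hA : 0 < A) (B D : ℝ) :
    ∀ᶠ s : ℕ in atTop, 0 < A * (s : ℝ) ^ 2 + B * s + D := by
  filter_upwards [eventually_ge_atTop (max 1 ⌈(|B| + |D| + 1) / A⌉₊)] with s hs
  have h1 : (1 : ℝ) ≤ s := by exact_mod_cast le_trans (le_max_left _ _) hs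
  have h2 : (|B| + |D| + 1) / A ≤ s :=
    (Nat.le_ceil _).trans (by exact_mod_cast le_trans (le_max_right _ _) hs)
  rw [div_le_iff₀ hA] at h2
  have h3 := neg_abs_le B
  have h4 := neg_abs_le D
  nlinarith [mul_le_mul_of_nonneg_right h2 (by linarith : (0 : ℝ) ≤ s),
    mul_le_mul_of_nonneg_left h1 (abs_nonneg D), abs_nonneg D, abs_nonneg B,
    mul_le_mul_of_nonneg_right h3 (by linarith : (0 : ℝ) ≤ s)]

/-- A codeword whose normalized score exceeds the Koetter-Vardy threshold is on the list, once the
total multiplicity is large. -/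
theorem eventually_mem_kvList {F ι : Type} [Field F] [Fintype F] [Fintype ι] {x : ι → F}
    (hx : Function.Injective x) {k : ℕ} {P : ι → F → ℝ} (hP : ∀ i α, 0 ≤ P i α) {f : F[X]}
    (hf : f.degree < (k : WithBot ℕ)) (h0 : 0 < score P fun i => f.eval (x i))
    (h : ((k - 1 : ℕ) : ℝ) * ∑ i, ∑ α, P i α ^ 2 < score P (fun i => f.eval (x i)) ^ 2) :
    ∀ᶠ s in atTop, (fun i => f.eval (x i)) ∈ kvList x k s P := by
  classical
  set σ := score P fun i => f.eval (x i) with hσ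
  have hne : Nonempty (ι × F) := by
    by_contra hc
    have : IsEmpty ι := ⟨fun i => hc ⟨(i, 0)⟩⟩
    simp [hσ, score] at h0
  set w := k - 1
  set T := ∑ a : ι × F, P a.1 a.2 with hT
  set N : ℝ := (Fintype.card (ι × F) : ℝ) with hN
  set n : ℝ := (Fintype.card ι : ℝ) with hn
  set E := ∑ a : ι × F, P a.1 a.2 ^ 2 with hE
  have hE' : ∑ i, ∑ α, P i α ^ 2 = E := by rw [hE, Fintype.sum_prod_type]
  rw [hE'] at h
  have hσT : σ ≤ T := by
    rw [hσ, hT, Fintype.sum_prod_type]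
    exact Finset.sum_le_sum fun i _ =>
      Finset.single_le_sum (f := fun α => P i α) (fun α _ => hP i α) (Finset.mem_univ _)
  have hTpos : 0 < T := lt_of_lt_of_le h0 hσT
  -- Summing the greedy invariant over one index or the other confines each multiplicity to s·P/T up
  -- to an error bounded in s.
  have hlow : ∀ s : ℕ, ∀ b : ι × F, P b.1 b.2 * s ≤ T * (multMatrix P s b + 1) := fun s b => by
    have h1 : ∑ a, P b.1 b.2 * (multMatrix P s a : ℝ) ≤
        ∑ a : ι × F, P a.1 a.2 * (multMatrix P s b + 1) :=
      Finset.sum_le_sum fun a _ => mul_multMatrix_le hP s a b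
    rw [← Finset.mul_sum, ← Finset.sum_mul, ← Nat.cast_sum, sum_multMatrix] at h1
    exact h1
  have hup : ∀ s : ℕ, ∀ a : ι × F, T * multMatrix P s a ≤ P a.1 a.2 * (s + N) := fun s a => by
    have h1 : ∑ b : ι × F, P b.1 b.2 * (multMatrix P s a : ℝ) ≤
        ∑ b, P a.1 a.2 * ((multMatrix P s b : ℝ) + 1) :=
      Finset.sum_le_sum fun b _ => mul_multMatrix_le hP s a b
    rw [← Finset.mul_sum, ← Finset.sum_mul, Finset.sum_add_distrib, ← Nat.cast_sum,
      sum_multMatrix] at h1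
    simpa only [Finset.sum_const, Finset.card_univ, nsmul_eq_mul, mul_one] using h1
  -- The quadratic is (σs - nT)² - w(E(s + N)² + T²s), expanded in s; its leading coefficient σ² -
  -- wE is positive by hypothesis.
  filter_upwards [eventually_quadratic_pos (sub_pos.2 h)
      (-(2 * σ * n * T) - w * (2 * E * N + T ^ 2)) ((n * T) ^ 2 - w * (E * N ^ 2)),
    eventually_gt_atTop ⌈n * T / σ⌉₊] with s hs hs'
  have hs1 : n * T < σ * s := by
    have := (Nat.le_ceil (n * T / σ)).trans_lt (by exact_mod_cast hs' : (_ : ℝ) < s)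
    rw [div_lt_iff₀ h0] at this
    linarith
  have hS : σ * s - n * T ≤ T * (∑ i, multMatrix P s (i, f.eval (x i)) : ℕ) := by
    have : ∑ i, P i (f.eval (x i)) * s ≤ ∑ i, T * ((multMatrix P s (i, f.eval (x i)) : ℝ) + 1) :=
      Finset.sum_le_sum fun i _ => hlow s (i, f.eval (x i))
    rw [← Finset.sum_mul, ← Finset.mul_sum, Finset.sum_add_distrib] at this
    simp only [Finset.sum_const, Finset.card_univ, nsmul_eq_mul, mul_one] at this
    have h3 : σ = ∑ i, P i (f.eval (x i)) := rfl
    rw [← h3] at this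
    push_cast
    linarith
  have hC : T ^ 2 * ((∑ a, multMatrix P s a * (multMatrix P s a + 1) : ℕ) : ℝ) ≤
      E * (s + N) ^ 2 + T ^ 2 * s := by
    have h1 : ∑ a, multMatrix P s a * (multMatrix P s a + 1) =
        ∑ a, multMatrix P s a ^ 2 + s := by
      conv_rhs => rhs; rw [← sum_multMatrix P s]
      rw [← Finset.sum_add_distrib]
      exact Finset.sum_congr rfl fun a _ => by ring
    rw [h1]
    push_cast
    rw [mul_add, Finset.mul_sum, hE, Finset.sum_mul]
    refine add_le_add (Finset.sum_le_sum fun a _ => ?_) le_rfl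
    rw [← mul_pow, ← mul_pow]
    exact pow_le_pow_left₀ (by positivity) (hup s a) 2
  have hSpos : 0 < ∑ i, multMatrix P s (i, f.eval (x i)) := by
    by_contra hc
    have : ∑ i, multMatrix P s (i, f.eval (x i)) = 0 := by omega
    rw [this] at hS
    simp at hS
    linarith
  refine mem_kvList_of_cost hx hf hSpos ?_
  set Sn := ∑ i, multMatrix P s (i, f.eval (x i))
  set Cn := ∑ a, multMatrix P s a * (multMatrix P s a + 1)
  have hfin : (w : ℝ) * Cn < (Sn : ℝ) ^ 2 := by
    refine lt_of_mul_lt_mul_left (a := T ^ 2) ?_ (by positivity)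
    have h1 : (σ * s - n * T) ^ 2 ≤ (T * Sn) ^ 2 := by
      gcongr
    have h2 : (w : ℝ) * (T ^ 2 * Cn) ≤ w * (E * (s + N) ^ 2 + T ^ 2 * s) := by gcongr
    nlinarith
  exact_mod_cast hfin

/-! ### The output of the decoder -/

theorem mem_rsCode {F ι : Type} [Field F] {x : ι → F} {k : ℕ} {c : ι → F} :
    c ∈ rsCode x k ↔ ∃ f : F[X], f.degree < (k : WithBot ℕ) ∧ c = fun i => f.eval (x i) := by
  simp only [rsCode, Submodule.mem_map, mem_degreeLT]
  refine exists_congr fun f => and_congr_right fun _ => ?_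
  rw [eq_comm]
  rfl

/-- The list contains only codewords, so a listed word that strictly beats the whole code is the
unique maximizer, whatever choice is made. -/
theorem kvDecode_eq_some {F ι : Type} [Field F] [Fintype ι] {x : ι → F} {k s : ℕ}
    {P : ι → F → ℝ} {c : ι → F} (hc : c ∈ kvList x k s P)
    (h : ∀ c' ∈ rsCode x k, c' ≠ c → score P c' < score P c) : kvDecode x k s P = some c := by
  have hsub : ∀ c' ∈ kvList x k s P, c' ∈ rsCode x k := by
    rintro c' ⟨f, hf, -, rfl⟩
    exact mem_rsCode.2 ⟨f, hf, rfl⟩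
  have hex : ∃ c ∈ kvList x k s P, ∀ c' ∈ kvList x k s P, score P c' ≤ score P c := by
    refine ⟨c, hc, fun c' hc' => ?_⟩
    by_cases he : c' = c
    · rw [he]
    · exact (h c' (hsub c' hc') he).le
  rw [kvDecode, dif_pos hex]
  congr 1
  by_contra hne
  have h1 := h _ (hsub _ hex.choose_spec.1) hne
  have h2 := hex.choose_spec.2 c hc
  linarith

/-! ### Product weights -/

open Classical in
/-- The total weight of the words `e` with `A e`, for the product of the weights `μ`. -/
noncomputable def prodProb {E ι : Type} [Fintype E] [Fintype ι] (μ : E → ℝ)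
    (A : (ι → E) → Prop) : ℝ :=
  ∑ e : ι → E, if A e then ∏ i, μ (e i) else 0

theorem prodProb_mono {E ι : Type} [Fintype E] [Fintype ι] {μ : E → ℝ} (hμ : ∀ e, 0 ≤ μ e)
    {A B : (ι → E) → Prop} (h : ∀ e, A e → B e) : prodProb μ A ≤ prodProb μ B :=
  Finset.sum_le_sum fun e _ => by
    have := Finset.prod_nonneg fun i (_ : i ∈ Finset.univ) => hμ (e i)
    by_cases hA : A e
    · rw [if_pos hA, if_pos (h e hA)]
    · rw [if_neg hA]
      split_ifs <;> simp [this]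

theorem prodProb_or_le {E ι : Type} [Fintype E] [Fintype ι] {μ : E → ℝ} (hμ : ∀ e, 0 ≤ μ e)
    (A B : (ι → E) → Prop) : prodProb μ (fun e => A e ∨ B e) ≤ prodProb μ A + prodProb μ B := by
  rw [prodProb, prodProb, prodProb, ← Finset.sum_add_distrib]
  refine Finset.sum_le_sum fun e _ => ?_
  have := Finset.prod_nonneg fun i (_ : i ∈ Finset.univ) => hμ (e i)
  by_cases hA : A e <;> by_cases hB : B e <;> simp [hA, hB, this]

theorem prodProb_exists_le {E ι J : Type} [Fintype E] [Fintype ι] {μ : E → ℝ}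
    (hμ : ∀ e, 0 ≤ μ e) (s : Finset J) (A : J → (ι → E) → Prop) :
    prodProb μ (fun e => ∃ j ∈ s, A j e) ≤ ∑ j ∈ s, prodProb μ (A j) := by
  classical
  induction s using Finset.induction_on with
  | empty => simp [prodProb]
  | insert j s hj ih =>
    rw [Finset.sum_insert hj]
    refine le_trans ?_ ((prodProb_or_le hμ _ _).trans (add_le_add le_rfl ih))
    refine prodProb_mono hμ fun e => ?_
    rintro ⟨l, hl, hA⟩
    rcases Finset.mem_insert.1 hl with rfl | hl
    · exact Or.inl hA
    · exact Or.inr ⟨l, hl, hA⟩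

open Classical in
theorem prodProb_forall {E ι : Type} [Fintype E] [Fintype ι] (μ : E → ℝ) (A : ι → E → Prop) :
    prodProb μ (fun e => ∀ i, A i (e i)) = ∏ i, ∑ a, if A i a then μ a else 0 := by
  classical
  rw [Finset.prod_univ_sum, Fintype.piFinset_univ, prodProb]
  refine Finset.sum_congr rfl fun e _ => ?_
  split_ifs with h
  · exact Finset.prod_congr rfl fun i _ => (if_pos (h i)).symm
  · push Not at h
    obtain ⟨i, hi⟩ := h
    exact (Finset.prod_eq_zero (Finset.mem_univ i) (if_neg hi)).symm

/-- A Chernoff bound for sums of independent bounded centred variables. -/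
theorem prodProb_sum_ge_le {E ι : Type} [Fintype E] [Fintype ι] {μ : E → ℝ} (hμ : ∀ e, 0 ≤ μ e)
    (hμ1 : ∑ e, μ e = 1) {h : E → ℝ} (hh : ∀ e, |h e| ≤ 1) (hm : ∑ e, μ e * h e = 0) {δ : ℝ}
    (hδ : 0 ≤ δ) (hδ2 : δ ≤ 2) :
    prodProb μ (fun e : ι → E => δ * Fintype.card ι ≤ ∑ i, h (e i)) ≤
      Real.exp (-(δ ^ 2 / 4) * Fintype.card ι) := by
  classical
  set n : ℝ := (Fintype.card ι : ℝ)
  -- This value minimizes the exponent l² - lδ, giving -δ²/4. The bound δ ≤ 2 ensures |l h| ≤ 1,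
  -- where exp(t) ≤ 1 + t + t² is available.
  set l := δ / 2
  have h1 : ∀ a, μ a * Real.exp (l * h a) ≤ μ a * (1 + l * h a + l ^ 2) := fun a => by
    refine mul_le_mul_of_nonneg_left ?_ (hμ a)
    have hab := abs_le.1 (hh a)
    have hx : |l * h a| ≤ 1 := by
      rw [abs_mul, abs_of_nonneg (by positivity : 0 ≤ l)]
      exact mul_le_one₀ (by simp only [l]; linarith) (abs_nonneg _) (hh a)
    have h2 := (abs_le.1 (Real.abs_exp_sub_one_sub_id_le hx)).2
    have h3 : h a ^ 2 ≤ 1 := by nlinarith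
    nlinarith [sq_nonneg l, mul_le_mul_of_nonneg_left h3 (sq_nonneg l)]
  have h2 : ∑ a, μ a * Real.exp (l * h a) ≤ Real.exp (l ^ 2) := by
    calc ∑ a, μ a * Real.exp (l * h a) ≤ ∑ a, μ a * (1 + l * h a + l ^ 2) :=
          Finset.sum_le_sum fun a _ => h1 a
      _ = (1 + l ^ 2) * ∑ a, μ a + l * ∑ a, μ a * h a := by
          rw [Finset.mul_sum, Finset.mul_sum, ← Finset.sum_add_distrib]
          exact Finset.sum_congr rfl fun a _ => by ring
      _ = 1 + l ^ 2 := by rw [hμ1, hm]; ring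
      _ ≤ Real.exp (l ^ 2) := by rw [add_comm]; exact Real.add_one_le_exp _
  calc prodProb μ (fun e : ι → E => δ * n ≤ ∑ i, h (e i))
      ≤ ∑ e : ι → E, (∏ i, μ (e i) * Real.exp (l * h (e i))) * Real.exp (-(l * (δ * n))) := by
        refine Finset.sum_le_sum fun e _ => ?_
        have hp := Finset.prod_nonneg fun i (_ : i ∈ Finset.univ) => hμ (e i)
        rw [Finset.prod_mul_distrib, ← Real.exp_sum, mul_assoc, ← Real.exp_add, ← Finset.mul_sum]
        split_ifs with hc
        · refine le_mul_of_one_le_right hp (Real.one_le_exp ?_)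
          have : 0 ≤ l * (∑ i, h (e i) - δ * n) := mul_nonneg (by positivity) (by linarith)
          linarith
        · positivity
    _ = (∑ a, μ a * Real.exp (l * h a)) ^ Fintype.card ι * Real.exp (-(l * (δ * n))) := by
        rw [← Finset.sum_mul]
        congr 1
        rw [← Finset.card_univ, ← Finset.prod_const, Finset.prod_univ_sum, Fintype.piFinset_univ]
    _ ≤ Real.exp (l ^ 2) ^ Fintype.card ι * Real.exp (-(l * (δ * n))) := by
        gcongr
        exact Finset.sum_nonneg fun a _ => mul_nonneg (hμ a) (Real.exp_pos _).le
    _ = Real.exp (-(δ ^ 2 / 4) * n) := by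
        rw [← Real.exp_nat_mul, ← Real.exp_add]
        congr 1
        simp only [l, n]
        ring

/-! ### Accidental agreement with a Reed-Solomon codeword -/

theorem eq_zero_of_mem_rsCode {F ι : Type} [Field F] {x : ι → F} (hx : Function.Injective x)
    {k : ℕ} {c : ι → F} (hc : c ∈ rsCode x k) (s : Finset ι) (hs : k ≤ s.card)
    (h : ∀ i ∈ s, c i = 0) : c = 0 := by
  obtain ⟨f, hf, rfl⟩ := mem_rsCode.1 hc
  have : f = 0 := eq_zero_of_degree_lt_of_eval_index_eq_zero s hx.injOn
    (hf.trans_le (by exact_mod_cast hs)) h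
  simp [this, Pi.zero_def]

/-- Restriction to k positions is injective on the code, so the sum is dominated by the sum over all
words on K, which factors. -/
theorem sum_rsCode_prod_le {F ι : Type} [Field F] [Fintype F] [Fintype ι] {x : ι → F}
    (hx : Function.Injective x) {k : ℕ} {r : F → ℝ} (hr : ∀ a, 0 ≤ r a) {K : Finset ι}
    (hK : K.card = k) {C : Finset (ι → F)} (hC : ∀ c ∈ C, c ∈ rsCode x k) :
    ∑ c ∈ C, ∏ i ∈ K, r (c i) ≤ (∑ a, r a) ^ k := by
  classical
  rw [← hK, ← Fintype.card_coe K, ← Finset.card_univ, ← Finset.prod_const, Finset.prod_univ_sum,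
    Fintype.piFinset_univ]
  have hinj : Set.InjOn (fun (c : ι → F) (i : K) => c i) C := by
    intro c hc c' hc' h
    have h0 := eq_zero_of_mem_rsCode hx (Submodule.sub_mem _ (hC c hc) (hC c' hc')) K hK.ge
      fun i hi => by
        have := congrFun h ⟨i, hi⟩
        simpa [sub_eq_zero] using this
    exact sub_eq_zero.1 h0
  calc ∑ c ∈ C, ∏ i ∈ K, r (c i)
      = ∑ c ∈ C, ∏ i : K, r ((fun (c : ι → F) (i : K) => c i) c i) :=
        Finset.sum_congr rfl fun c _ => (Finset.prod_coe_sort K fun i => r (c i)).symm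
    _ = ∑ g ∈ C.image (fun (c : ι → F) (i : K) => c i), ∏ i : K, r (g i) :=
        (Finset.sum_image (f := fun g : K → F => ∏ i : K, r (g i)) hinj).symm
    _ ≤ ∑ g : K → F, ∏ i : K, r (g i) :=
        Finset.sum_le_sum_of_subset_of_nonneg (Finset.subset_univ _) fun g _ _ =>
          Finset.prod_nonneg fun i _ => hr _

/-- With random candidates `cand (e i)` for the symbols, a nonzero codeword of a Reed-Solomon code
of dimension `k` rarely consists of candidates at `k + L` positions. -/
theorem prodProb_agreement_le {F E ι : Type} [Field F] [Fintype F] [Fintype E] [Fintype ι]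
    {x : ι → F} (hx : Function.Injective x) {μ : E → ℝ} (hμ : ∀ e, 0 ≤ μ e)
    (hμ1 : ∑ e, μ e = 1) {cand : E → F → Prop} [∀ e a, Decidable (cand e a)] {ρ : ℝ} (hρ : 0 ≤ ρ)
    (hρ2 : ρ * ((Fintype.card F : ℝ) - 1) ≤ 2)
    (hcand : ∀ a, a ≠ 0 → ∑ e, (if cand e a then μ e else 0) ≤ ρ) (k L : ℕ) :
    prodProb μ (fun e : ι → E => ∃ c ∈ rsCode x k, c ≠ 0 ∧ ∃ T : Finset ι, T.card = k + L ∧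
      ∀ i ∈ T, cand (e i) (c i)) ≤ 12 ^ Fintype.card ι * ρ ^ L := by
  classical
  by_cases hkn : Fintype.card ι < k + L
  · refine le_trans (le_of_eq ?_) (by positivity : (0 : ℝ) ≤ _)
    rw [prodProb]
    refine Finset.sum_eq_zero fun e _ => if_neg ?_
    rintro ⟨c, -, -, T, hT, -⟩
    have := T.card_le_univ
    omega
  push Not at hkn
  set n := Fintype.card ι
  let C : Finset (ι → F) := Finset.univ.filter fun c => c ∈ rsCode x k ∧ c ≠ 0
  -- Upper bound for the probability that a is a candidate. Nothing is assumed for a = 0, the symbol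
  -- without deviation, so the trivial bound 1 is used there.
  let r : F → ℝ := fun a => if a = 0 then 1 else ρ
  have hr0 : ∀ a, 0 ≤ r a := fun a => by simp only [r]; split_ifs <;> linarith
  have hr : ∀ a, ∑ e, (if cand e a then μ e else 0) ≤ r a := fun a => by
    simp only [r]
    split_ifs with ha
    · rw [← hμ1]
      exact Finset.sum_le_sum fun e _ => by split_ifs <;> simp [hμ]
    · exact hcand a ha
  have hrsum : ∑ a, r a ≤ 3 := by
    simp only [r]
    rw [← Finset.add_sum_erase _ _ (Finset.mem_univ (0 : F)), if_pos rfl,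
      Finset.sum_congr rfl fun a ha => if_neg (Finset.ne_of_mem_erase ha), Finset.sum_const,
      Finset.card_erase_of_mem (Finset.mem_univ _), Finset.card_univ, nsmul_eq_mul,
      Nat.cast_sub Fintype.card_pos]
    push_cast
    linarith
  have hone : ∀ T : Finset ι, ∀ c : ι → F,
      prodProb μ (fun e : ι → E => ∀ i ∈ T, cand (e i) (c i)) ≤ ∏ i ∈ T, r (c i) := fun T c => by
    rw [prodProb_forall μ fun i a => i ∈ T → cand a (c i), ← Finset.prod_subset T.subset_univ]
    · refine Finset.prod_le_prod
        (fun i _ => Finset.sum_nonneg fun e _ => by split_ifs <;> simp [hμ]) fun i hi => ?_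
      refine le_trans (le_of_eq ?_) (hr (c i))
      exact Finset.sum_congr rfl fun e _ => by simp [hi]
    · intro i _ hi
      simp [hi, hμ1]
  -- A nonzero codeword has at most k zeros, so some k-subset K of T contains all its zeros in T;
  -- each of the L remaining positions contributes a factor ρ.
  have hsplit : ∀ T : Finset ι, T.card = k + L → ∀ c ∈ C, ∏ i ∈ T, r (c i) ≤
      ∑ K ∈ Finset.univ.powersetCard k, (∏ i ∈ K, r (c i)) * ρ ^ L := fun T hT c hc => by
    obtain ⟨hc1, hc2⟩ := (Finset.mem_filter.1 hc).2
    have hZ : (T.filter fun i => c i = 0).card ≤ k := by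
      by_contra hlt
      exact hc2 (eq_zero_of_mem_rsCode hx hc1 _ (le_of_not_ge hlt)
        fun i hi => (Finset.mem_filter.1 hi).2)
    obtain ⟨K, hK1, hK2, hK3⟩ := Finset.exists_subsuperset_card_eq
      (Finset.filter_subset (fun i => c i = 0) T) hZ (by omega)
    calc ∏ i ∈ T, r (c i) = (∏ i ∈ K, r (c i)) * ρ ^ L := by
          rw [← Finset.prod_sdiff hK2, mul_comm]
          congr 1
          have hL : (T \ K).card = L := by rw [Finset.card_sdiff_of_subset hK2]; omega
          rw [← hL, ← Finset.prod_const]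
          refine Finset.prod_congr rfl fun i hi => if_neg fun h0 => ?_
          rw [Finset.mem_sdiff] at hi
          exact hi.2 (hK1 (Finset.mem_filter.2 ⟨hi.1, h0⟩))
      _ ≤ _ := Finset.single_le_sum (f := fun K => (∏ i ∈ K, r (c i)) * ρ ^ L)
          (fun K _ => mul_nonneg (Finset.prod_nonneg fun i _ => hr0 _) (by positivity))
          (Finset.mem_powersetCard.2 ⟨K.subset_univ, hK3⟩)
  have hcard : ∀ j, ((Finset.univ.powersetCard j : Finset (Finset ι)).card : ℝ) ≤ 2 ^ n :=
    fun j => by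
      have := Finset.card_le_univ (Finset.univ.powersetCard j : Finset (Finset ι))
      rw [Fintype.card_finset] at this
      exact_mod_cast this
  calc prodProb μ (fun e : ι → E => ∃ c ∈ rsCode x k, c ≠ 0 ∧ ∃ T : Finset ι, T.card = k + L ∧
        ∀ i ∈ T, cand (e i) (c i))
      ≤ prodProb μ (fun e : ι → E => ∃ T ∈ Finset.univ.powersetCard (k + L), ∃ c ∈ C,
          ∀ i ∈ T, cand (e i) (c i)) := by
        refine prodProb_mono hμ fun e => ?_
        rintro ⟨c, hc, hc0, T, hT, h⟩
        exact ⟨T, Finset.mem_powersetCard.2 ⟨T.subset_univ, hT⟩, c, by simp [C, hc, hc0], h⟩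
    _ ≤ ∑ T ∈ Finset.univ.powersetCard (k + L), ∑ c ∈ C,
          prodProb μ (fun e : ι → E => ∀ i ∈ T, cand (e i) (c i)) :=
        (prodProb_exists_le hμ _ _).trans
          (Finset.sum_le_sum fun T _ => prodProb_exists_le hμ _ _)
    _ ≤ ∑ T ∈ (Finset.univ.powersetCard (k + L) : Finset (Finset ι)), ∑ c ∈ C,
          ∑ K ∈ Finset.univ.powersetCard k, (∏ i ∈ K, r (c i)) * ρ ^ L :=
        Finset.sum_le_sum fun T hT => Finset.sum_le_sum fun c hc =>
          (hone T c).trans (hsplit T (Finset.mem_powersetCard.1 hT).2 c hc)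
    _ ≤ ∑ T ∈ (Finset.univ.powersetCard (k + L) : Finset (Finset ι)),
          ∑ K ∈ (Finset.univ.powersetCard k : Finset (Finset ι)), 3 ^ n * ρ ^ L := by
        refine Finset.sum_le_sum fun T _ => ?_
        rw [Finset.sum_comm]
        refine Finset.sum_le_sum fun K hK => ?_
        rw [← Finset.sum_mul]
        gcongr
        refine (sum_rsCode_prod_le hx hr0 (Finset.mem_powersetCard.1 hK).2
          fun c hc => (Finset.mem_filter.1 hc).2.1).trans ?_
        calc (∑ a, r a) ^ k ≤ 3 ^ k :=
              pow_le_pow_left₀ (Finset.sum_nonneg fun a _ => hr0 a) hrsum k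
          _ ≤ 3 ^ n := pow_le_pow_right₀ (by norm_num) (by omega)
    _ ≤ 2 ^ n * (2 ^ n * (3 ^ n * ρ ^ L)) := by
        rw [Finset.sum_const, Finset.sum_const, nsmul_eq_mul, nsmul_eq_mul]
        gcongr <;> exact hcard _
    _ = 12 ^ n * ρ ^ L := by
        rw [← mul_assoc, ← mul_assoc, ← mul_pow, ← mul_pow]
        norm_num

/-! ### Koetter-Vardy decoding on translation invariant channels -/

/-- The posterior vector at a position at which `a` was sent is `π e` translated by `a`, where `e`
is the noise at this position. -/
theorem eventually_prodProb_kvDecode_le {F E ι : Type} [Field F] [Fintype F] [Fintype E]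
    [Fintype ι] [Nonempty ι] {x : ι → F} (hx : Function.Injective x) {μ : E → ℝ}
    (hμ : ∀ e, 0 ≤ μ e) (hμ1 : ∑ e, μ e = 1) {π : E → F → ℝ} (hπ : ∀ e a, 0 ≤ π e a)
    (hπ1 : ∀ e, ∑ a, π e a ≤ 1) {κ : ℝ} (hκ : ∑ e, μ e * π e 0 = κ)
    (hκ2 : ∑ e, μ e * ∑ a, π e a ^ 2 = κ) {cand : E → F → Prop}
    [∀ e a, Decidable (cand e a)] {ρ : ℝ} (hρ : 0 ≤ ρ)
    (hρ2 : ρ * ((Fintype.card F : ℝ) - 1) ≤ 2)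
    (hcand : ∀ a, a ≠ 0 → ∑ e, (if cand e a then μ e else 0) ≤ ρ)
    {δ : ℝ} (hδ : 0 < δ) (hδ2 : δ ≤ 2) (hη : ∀ e a, ¬ cand e a → π e a ≤ δ) {k L : ℕ}
    (hk : (k : ℝ) ≤ (κ - 3 * δ) * Fintype.card ι)
    (hkL : (k : ℝ) + L ≤ (κ - 2 * δ) * Fintype.card ι) :
    ∀ᶠ s in atTop, ∀ c ∈ rsCode x k,
      prodProb μ (fun e : ι → E => kvDecode x k s (fun i a => π (e i) (a - c i)) ≠ some c) ≤
        2 * Real.exp (-(δ ^ 2 / 4) * Fintype.card ι) + 12 ^ Fintype.card ι * ρ ^ L := by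
  classical
  set n : ℝ := (Fintype.card ι : ℝ) with hn
  have hnpos : 0 < n := Nat.cast_pos.2 Fintype.card_pos
  have hκδ : 3 * δ ≤ κ := by
    by_contra hc
    have : (κ - 3 * δ) * n < 0 := mul_neg_of_neg_of_pos (by linarith) hnpos
    have : (0 : ℝ) ≤ k := by positivity
    linarith
  have hle1 : ∀ e a, π e a ≤ 1 := fun e a =>
    (Finset.single_le_sum (f := fun a => π e a) (fun a _ => hπ e a) (Finset.mem_univ a)).trans
      (hπ1 e)
  have hsq : ∀ e, ∑ a, π e a ^ 2 ≤ 1 := fun e =>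
    (Finset.sum_le_sum fun a _ => by nlinarith [hπ e a, hle1 e a]).trans (hπ1 e)
  have hκ1 : κ ≤ 1 := by
    rw [← hκ, ← hμ1]
    exact Finset.sum_le_sum fun e _ => mul_le_of_le_one_right (hμ e) (hle1 e 0)
  have hκ0 : 0 ≤ κ := by linarith
  -- The three bad events: the score of the sent word is too small, the norm is too large, or a
  -- nonzero difference of codewords follows the candidates too often.
  let A1 : (ι → E) → Prop := fun e => δ * n ≤ ∑ i, (κ - π (e i) 0)
  let A2 : (ι → E) → Prop := fun e => δ * n ≤ ∑ i, ((∑ a, π (e i) a ^ 2) - κ)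
  let A3 : (ι → E) → Prop := fun e => ∃ c ∈ rsCode x k, c ≠ 0 ∧ ∃ T : Finset ι,
    T.card = k + L ∧ ∀ i ∈ T, cand (e i) (c i)
  have hA1 : prodProb μ A1 ≤ Real.exp (-(δ ^ 2 / 4) * n) := by
    refine prodProb_sum_ge_le (h := fun e => κ - π e 0) hμ hμ1 (fun e => ?_) ?_ hδ.le hδ2
    · rw [abs_le]
      constructor <;> linarith [hπ e 0, hle1 e 0]
    · simp only [mul_sub]
      rw [Finset.sum_sub_distrib, ← Finset.sum_mul, hμ1, hκ]
      ring
  have hA2 : prodProb μ A2 ≤ Real.exp (-(δ ^ 2 / 4) * n) := by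
    refine prodProb_sum_ge_le (h := fun e => (∑ a, π e a ^ 2) - κ) hμ hμ1 (fun e => ?_) ?_
      hδ.le hδ2
    · have : 0 ≤ ∑ a, π e a ^ 2 := Finset.sum_nonneg fun a _ => sq_nonneg _
      rw [abs_le]
      constructor <;> linarith [hsq e]
    · simp only [mul_sub]
      rw [Finset.sum_sub_distrib, ← Finset.sum_mul, hμ1, hκ2]
      ring
  have hA3 : prodProb μ A3 ≤ 12 ^ Fintype.card ι * ρ ^ L :=
    prodProb_agreement_le hx hμ hμ1 hρ hρ2 hcand k L
  -- The multiplicity needed depends on the codeword and the noise, but there are finitely many of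
  -- both, so one threshold serves all.
  have hgood : ∀ c : ι → F, ∀ e : ι → E, ∀ᶠ s in atTop, c ∈ rsCode x k →
      kvDecode x k s (fun i a => π (e i) (a - c i)) ≠ some c → A1 e ∨ A2 e ∨ A3 e := by
    intro c e
    by_cases hc : c ∈ rsCode x k
    swap
    · exact Eventually.of_forall fun s h => absurd h hc
    by_cases h1 : A1 e
    · exact Eventually.of_forall fun s _ _ => Or.inl h1
    by_cases h2 : A2 e
    · exact Eventually.of_forall fun s _ _ => Or.inr (Or.inl h2)
    by_cases h3 : A3 e
    · exact Eventually.of_forall fun s _ _ => Or.inr (Or.inr h3)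
    set P : ι → F → ℝ := fun i a => π (e i) (a - c i) with hP
    have hscore : (κ - δ) * n < score P c := by
      simp only [A1, not_le, Finset.sum_sub_distrib, Finset.sum_const, Finset.card_univ,
        nsmul_eq_mul] at h1
      have : score P c = ∑ i, π (e i) 0 := by simp [score, hP]
      rw [this]
      linarith
    have hnorm : ∑ i, ∑ a, P i a ^ 2 < (κ + δ) * n := by
      simp only [A2, not_le, Finset.sum_sub_distrib, Finset.sum_const, Finset.card_univ,
        nsmul_eq_mul] at h2
      have : ∑ i, ∑ a, P i a ^ 2 = ∑ i, ∑ a, π (e i) a ^ 2 :=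
        Finset.sum_congr rfl fun i _ =>
          (Equiv.subRight (c i)).sum_comp fun a => π (e i) a ^ 2
      rw [this]
      linarith
    have hbase : 0 < (κ - δ) * n := mul_pos (by linarith) hnpos
    have hothers : ∀ c' ∈ rsCode x k, c' ≠ c → score P c' < score P c := by
      intro c' hc' hne
      by_contra hcon
      push Not at hcon
      set T : Finset ι := Finset.univ.filter fun i => cand (e i) (c' i - c i) with hT
      -- Candidates score at most 1 and all other symbols at most δ. A rival scoring above (κ - δ)n
      -- thus has at least (κ - 2δ)n ≥ k + L candidate positions.
      have hle : score P c' ≤ T.card + δ * n := by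
        calc score P c' ≤ ∑ i, ((if cand (e i) (c' i - c i) then (1 : ℝ) else 0) + δ) := by
              refine Finset.sum_le_sum fun i _ => ?_
              simp only [hP]
              split_ifs with hcd
              · linarith [hle1 (e i) (c' i - c i)]
              · linarith [hη _ _ hcd]
          _ = T.card + δ * n := by
              rw [Finset.sum_add_distrib, Finset.sum_boole, Finset.sum_const, Finset.card_univ,
                nsmul_eq_mul, mul_comm]
      have hTc : k + L ≤ T.card := by
        have : (k : ℝ) + L ≤ T.card := by nlinarith
        exact_mod_cast this
      obtain ⟨T', hT', hcard⟩ := Finset.exists_subset_card_eq hTc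
      exact h3 ⟨c' - c, Submodule.sub_mem _ hc' hc, sub_ne_zero.2 hne, T', hcard,
        fun i hi => (Finset.mem_filter.1 (hT' hi)).2⟩
    obtain ⟨f, hf, hfc⟩ := mem_rsCode.1 hc
    have hlist : ∀ᶠ s in atTop, (fun i => f.eval (x i)) ∈ kvList x k s P := by
      refine eventually_mem_kvList hx (fun i a => hπ _ _) hf ?_ ?_
      · rw [← hfc]
        linarith
      · rw [← hfc]
        -- The margin is (κ - δ)² - (κ - 3δ)(κ + δ) = 4δ².
        calc ((k - 1 : ℕ) : ℝ) * ∑ i, ∑ a, P i a ^ 2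
            ≤ ((κ - 3 * δ) * n) * ((κ + δ) * n) := by
              refine mul_le_mul (le_trans (by exact_mod_cast Nat.sub_le k 1) hk) hnorm.le
                (Finset.sum_nonneg fun i _ => Finset.sum_nonneg fun a _ => sq_nonneg _) ?_
              exact le_trans (by positivity) hk
          _ < ((κ - δ) * n) ^ 2 := by
              nlinarith [mul_pos (mul_pos hδ hδ) (mul_pos hnpos hnpos)]
          _ ≤ score P c ^ 2 := by gcongr
    filter_upwards [hlist] with s hs _ hbad
    rw [← hfc] at hs
    exact absurd (kvDecode_eq_some hs hothers) hbad
  have hall := eventually_all.2 fun c => eventually_all.2 fun e => hgood c e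
  filter_upwards [hall] with s hs c hc
  calc prodProb μ (fun e : ι → E => kvDecode x k s (fun i a => π (e i) (a - c i)) ≠ some c)
      ≤ prodProb μ (fun e => A1 e ∨ A2 e ∨ A3 e) := prodProb_mono hμ fun e => hs c e hc
    _ ≤ prodProb μ A1 + (prodProb μ A2 + prodProb μ A3) :=
        (prodProb_or_le hμ _ _).trans (add_le_add le_rfl (prodProb_or_le hμ _ _))
    _ ≤ _ := by linarith

/-! ### The symmetric channel -/

/-- The probability that a given wrong symbol is received on the symmetric channel. -/
noncomputable def crossProb (F : Type) [Fintype F] (p : ℝ) : ℝ := p / ((Fintype.card F : ℝ) - 1)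

/-- The excess of the probability of the correct symbol over that of a wrong symbol. -/
noncomputable def excess (F : Type) [Fintype F] (p : ℝ) : ℝ := 1 - p - crossProb F p

open Classical in
/-- The probability that two independent noise symbols differ by `b`. -/
noncomputable def diffProb (F : Type) [Field F] [Fintype F] (p : ℝ) (b : F) : ℝ :=
  (if b = 0 then excess F p ^ 2 else 0) + (1 - excess F p ^ 2) / (Fintype.card F : ℝ)

/-- The weight of a pair of independent noise symbols. -/
noncomputable def noise (F : Type) [Field F] [Fintype F] (p : ℝ) (e : F × F) : ℝ :=
  qSC F p 0 e.1 * qSC F p 0 e.2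

/-- The a posteriori probabilities of the input of `channelV` if `e` is received. -/
noncomputable def postV (F : Type) [Field F] [Fintype F] (p : ℝ) (e : F × F) (a : F) : ℝ :=
  app (channelV (qSC F p)) e a

/-- The a posteriori probabilities of the input of `channelU` if `e` is received, with zero as the
known symbol. -/
noncomputable def postU (F : Type) [Field F] [Fintype F] (p : ℝ) (e : F × F) (a : F) : ℝ :=
  app (channelU (qSC F p)) (e.1, e.2, 0) a

open Classical in
theorem qSC_eq {F : Type} [Fintype F] {p : ℝ} (a y : F) :
    qSC F p a y = crossProb F p + if y = a then excess F p else 0 := by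
  rw [qSC, excess, ← crossProb]
  split_ifs <;> ring

section Channel

variable {F : Type} [Field F] [Fintype F] {p : ℝ}

theorem two_le_card (F : Type) [Field F] [Fintype F] : (2 : ℝ) ≤ Fintype.card F := by
  exact_mod_cast Fintype.one_lt_card (α := F)

theorem card_sub_one_mul_crossProb (F : Type) [Field F] [Fintype F] (p : ℝ) :
    ((Fintype.card F : ℝ) - 1) * crossProb F p = p := by
  have := two_le_card F
  rw [crossProb, mul_div_cancel₀]
  linarith

theorem crossProb_nonneg (hp : p ∈ Set.Icc (0 : ℝ) 1) : 0 ≤ crossProb F p := by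
  have := two_le_card F
  exact div_nonneg hp.1 (by linarith)

theorem crossProb_le (hp : p ∈ Set.Icc (0 : ℝ) 1) :
    crossProb F p ≤ 1 / ((Fintype.card F : ℝ) - 1) := by
  have := two_le_card F
  exact div_le_div_of_nonneg_right hp.2 (by linarith)

theorem crossProb_le_two_div (hp : p ∈ Set.Icc (0 : ℝ) 1) :
    crossProb F p ≤ 2 / (Fintype.card F : ℝ) := by
  have := two_le_card F
  refine (crossProb_le hp).trans ?_
  rw [div_le_div_iff₀ (by linarith) (by linarith)]
  linarith

theorem crossProb_le_self (hp : p ∈ Set.Icc (0 : ℝ) 1) : crossProb F p ≤ p := by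
  have := two_le_card F
  exact div_le_self hp.1 (by linarith)

theorem excess_eq (F : Type) [Field F] [Fintype F] (p : ℝ) :
    excess F p = 1 - Fintype.card F * crossProb F p := by
  rw [excess]
  linear_combination card_sub_one_mul_crossProb F p

theorem excess_sq_le_one (hp : p ∈ Set.Icc (0 : ℝ) 1) : excess F p ^ 2 ≤ 1 := by
  have h1 := crossProb_nonneg (F := F) hp
  have h2 := crossProb_le_self (F := F) hp
  have := hp.1
  have := hp.2
  rw [sq_le_one_iff_abs_le_one, abs_le, excess]
  constructor <;> linarith

theorem one_sub_excess_sq_div (F : Type) [Field F] [Fintype F] (p : ℝ) :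
    (1 - excess F p ^ 2) / (Fintype.card F : ℝ) = crossProb F p * (1 + excess F p) := by
  have := two_le_card F
  rw [div_eq_iff (by linarith)]
  linear_combination (-1 - excess F p) * excess_eq F p

theorem qSC_eq_zero_sub (a y : F) : qSC F p a y = qSC F p 0 (y - a) := by
  by_cases h : y = a <;> simp [qSC, h, sub_eq_zero]

theorem qSC_nonneg (hp : p ∈ Set.Icc (0 : ℝ) 1) (a y : F) : 0 ≤ qSC F p a y := by
  have := crossProb_nonneg (F := F) hp
  rw [qSC, ← crossProb]
  split_ifs
  · linarith [hp.2]
  · exact this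

theorem sum_qSC_zero (F : Type) [Field F] [Fintype F] (p : ℝ) : ∑ y, qSC F p 0 y = 1 := by
  classical
  simp only [qSC_eq, Finset.sum_add_distrib, Finset.sum_ite_eq', Finset.mem_univ, if_true,
    Finset.sum_const, Finset.card_univ, nsmul_eq_mul, excess_eq]
  ring

theorem noise_nonneg (hp : p ∈ Set.Icc (0 : ℝ) 1) (e : F × F) : 0 ≤ noise F p e :=
  mul_nonneg (qSC_nonneg hp _ _) (qSC_nonneg hp _ _)

theorem sum_noise (F : Type) [Field F] [Fintype F] (p : ℝ) : ∑ e, noise F p e = 1 := by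
  simp only [noise]
  rw [Fintype.sum_prod_type]
  simp only [← Finset.mul_sum, sum_qSC_zero, mul_one]

theorem sum_qSC_mul_shift (b : F) :
    ∑ u, qSC F p 0 u * qSC F p 0 (u + b) = diffProb F p b := by
  classical
  set r := crossProb F p
  set d := excess F p
  have h1 : ∀ u : F, qSC F p 0 u * qSC F p 0 (u + b) =
      r ^ 2 + (if u = -b then r * d else 0) +
        (if u = 0 then d * (r + if b = 0 then d else 0) else 0) := fun u => by
    rw [qSC_eq, qSC_eq]
    by_cases hu : u = 0
    · subst hu
      by_cases hb : b = 0
      · simp [hb, r, d]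
        ring
      · simp [hb, eq_comm (a := (0 : F)), r, d]
        ring
    · by_cases hub : u = -b
      · simp [hub, r, d]
        simp [hub] at hu
        simp [hu]
        ring
      · simp [hu, hub, add_eq_zero_iff_eq_neg, r]
        ring
  simp only [h1, Finset.sum_add_distrib, Finset.sum_ite_eq', Finset.mem_univ, if_true,
    Finset.sum_const, Finset.card_univ, nsmul_eq_mul]
  rw [diffProb, one_sub_excess_sq_div]
  have h2 : d = 1 - Fintype.card F * r := excess_eq F p
  split_ifs
  · linear_combination r * h2
  · linear_combination r * h2

theorem diffProb_nonneg (hp : p ∈ Set.Icc (0 : ℝ) 1) (b : F) : 0 ≤ diffProb F p b := by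
  rw [← sum_qSC_mul_shift]
  exact Finset.sum_nonneg fun u _ => mul_nonneg (qSC_nonneg hp _ _) (qSC_nonneg hp _ _)

theorem diffProb_of_ne_zero {b : F} (hb : b ≠ 0) :
    diffProb F p b = crossProb F p * (1 + excess F p) := by
  rw [diffProb, if_neg hb, zero_add, one_sub_excess_sq_div]

theorem diffProb_zero (F : Type) [Field F] [Fintype F] (p : ℝ) :
    diffProb F p 0 = excess F p ^ 2 + crossProb F p * (1 + excess F p) := by
  rw [diffProb, if_pos rfl, one_sub_excess_sq_div]

theorem sum_diffProb (F : Type) [Field F] [Fintype F] (p : ℝ) : ∑ b, diffProb F p b = 1 := by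
  classical
  have := two_le_card F
  simp only [diffProb, Finset.sum_add_distrib, Finset.sum_ite_eq', Finset.mem_univ, if_true,
    Finset.sum_const, Finset.card_univ, nsmul_eq_mul]
  field_simp
  ring

theorem sum_diffProb_sq (F : Type) [Field F] [Fintype F] (p : ℝ) :
    ∑ b, diffProb F p b ^ 2 =
      excess F p ^ 4 + (1 - excess F p ^ 4) / (Fintype.card F : ℝ) := by
  classical
  have := two_le_card F
  have h1 : ∀ b : F, diffProb F p b ^ 2 =
      (if b = 0 then excess F p ^ 4 + 2 * excess F p ^ 2 *
        ((1 - excess F p ^ 2) / (Fintype.card F : ℝ)) else 0) +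
        ((1 - excess F p ^ 2) / (Fintype.card F : ℝ)) ^ 2 := fun b => by
    rw [diffProb]
    split_ifs <;> ring
  simp only [h1, Finset.sum_add_distrib, Finset.sum_ite_eq', Finset.mem_univ, if_true,
    Finset.sum_const, Finset.card_univ, nsmul_eq_mul]
  field_simp
  ring

/-- Summation over noise pairs of a function of the difference. -/
theorem sum_noise_mul (g : F → ℝ) :
    ∑ e : F × F, noise F p e * g (e.2 - e.1) = ∑ b, diffProb F p b * g b := by
  rw [Fintype.sum_prod_type]
  have h1 : ∀ u : F, ∑ y, noise F p (u, y) * g (y - u) =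
      ∑ b, qSC F p 0 u * qSC F p 0 (u + b) * g b := fun u => by
    rw [← Equiv.sum_comp (Equiv.addLeft u)]
    simp [noise]
  simp only [h1]
  rw [Finset.sum_comm]
  simp only [← Finset.sum_mul, sum_qSC_mul_shift]

/-! ### Posterior probabilities and Koetter–Vardy capacities of the two channels. -/

theorem sum_qSC_mul_qSC (α : F) (y : F × F) :
    ∑ u, qSC F p u y.1 * qSC F p (u + α) y.2 = diffProb F p (y.2 - y.1 - α) := by
  rw [← sum_qSC_mul_shift, ← (Equiv.subLeft y.1).sum_comp]
  refine Finset.sum_congr rfl fun u _ => ?_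
  rw [qSC_eq_zero_sub, qSC_eq_zero_sub (_ + _)]
  simp only [Equiv.subLeft_apply]
  congr 2 <;> ring

theorem channelV_qSC (α : F) (y : F × F) :
    channelV (qSC F p) α y = 1 / (Fintype.card F : ℝ) * diffProb F p (y.2 - y.1 - α) := by
  rw [channelV, sum_qSC_mul_qSC]

theorem app_channelV (y : F × F) (α : F) :
    app (channelV (qSC F p)) y α = diffProb F p (y.2 - y.1 - α) := by
  have := two_le_card F
  have h1 : ∑ β, diffProb F p (y.2 - y.1 - β) = 1 := by
    rw [← sum_diffProb F p]
    exact (Equiv.subLeft (y.2 - y.1)).sum_comp (diffProb F p)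
  simp only [app, channelV_qSC]
  rw [← Finset.mul_sum, h1]
  field_simp

theorem sum_app_channelV_sq (y : F × F) :
    ∑ α, app (channelV (qSC F p)) y α ^ 2 = ∑ b, diffProb F p b ^ 2 := by
  simp only [app_channelV]
  exact (Equiv.subLeft (y.2 - y.1)).sum_comp (fun b => diffProb F p b ^ 2)

theorem kvCapacity_channelV (F : Type) [Field F] [Fintype F] (p : ℝ) :
    kvCapacity (channelV (qSC F p)) = ∑ b, diffProb F p b ^ 2 := by
  have := two_le_card F
  have h1 : ∀ x : F, ∑ y, channelV (qSC F p) x y = 1 := fun x => by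
    simp only [channelV_qSC]
    rw [Fintype.sum_prod_type]
    have : ∀ y₁ : F, ∑ y₂, diffProb F p (y₂ - y₁ - x) = 1 := fun y₁ => by
      rw [← sum_diffProb F p, ← (Equiv.subRight (y₁ + x)).sum_comp (diffProb F p)]
      simp [sub_sub]
    simp only [← Finset.mul_sum, this]
    simp
  simp only [kvCapacity, sum_app_channelV_sq, ← Finset.sum_mul, h1]
  simp

theorem app_channelU (e : F × F) (u v α : F) :
    app (channelU (qSC F p)) (e.1 + u, e.2 + (u + v), v) α =
      qSC F p 0 (e.1 + u - α) * qSC F p 0 (e.2 + u - α) / diffProb F p (e.2 - e.1) := by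
  have := two_le_card F
  have h1 : ∀ β : F, channelU (qSC F p) β (e.1 + u, e.2 + (u + v), v) =
      1 / (Fintype.card F : ℝ) * (qSC F p 0 (e.1 + u - β) * qSC F p 0 (e.2 + u - β)) := fun β => by
    rw [channelU, qSC_eq_zero_sub, qSC_eq_zero_sub (_ + _)]
    congr 3
    ring
  have h2 : ∑ β : F, qSC F p 0 (e.1 + u - β) * qSC F p 0 (e.2 + u - β) =
      diffProb F p (e.2 - e.1) := by
    rw [← sum_qSC_mul_shift, ← (Equiv.subLeft (e.1 + u)).sum_comp]
    refine Finset.sum_congr rfl fun u _ => ?_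
    simp only [Equiv.subLeft_apply]
    congr 2 <;> ring
  simp only [app, h1]
  rw [← Finset.mul_sum, h2, mul_div_mul_left _ _ (by positivity)]

theorem postU_eq (e : F × F) (a : F) : postU F p e a =
    qSC F p 0 (e.1 - a) * qSC F p 0 (e.2 - a) / diffProb F p (e.2 - e.1) := by
  have := app_channelU (p := p) e 0 0 a
  simpa [postU] using this

theorem postV_eq (e : F × F) (a : F) : postV F p e a = diffProb F p (e.2 - e.1 - a) :=
  app_channelV e a

theorem app_channelU_eq_postU (e : F × F) (u v α : F) :
    app (channelU (qSC F p)) (e.1 + u, e.2 + (u + v), v) α = postU F p e (α - u) := by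
  rw [app_channelU, postU_eq]
  congr 3 <;> ring

theorem app_channelV_eq_postV (e : F × F) (u v α : F) :
    app (channelV (qSC F p)) (e.1 + u, e.2 + (u + v)) α = postV F p e (α - v) := by
  rw [app_channelV, postV_eq]
  congr 1
  ring

theorem kvCapacity_channelU (F : Type) [Field F] [Fintype F] (p : ℝ) :
    kvCapacity (channelU (qSC F p)) = ∑ e, noise F p e * ∑ a, postU F p e a ^ 2 := by
  have := two_le_card F
  have h1 : ∀ x : F, ∑ y, channelU (qSC F p) x y * ∑ α, app (channelU (qSC F p)) y α ^ 2 =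
      ∑ e, noise F p e * ∑ a, postU F p e a ^ 2 := fun x => by
    -- Outputs are reparametrized by the known symbol and the noise pair; the summand does not
    -- depend on the known symbol, which cancels the factor 1/q.
    let φ : F × (F × F) ≃ F × F × F :=
      { toFun := fun t => (t.2.1 + x, t.2.2 + (x + t.1), t.1)
        invFun := fun y => (y.2.2, y.1 - x, y.2.1 - (x + y.2.2))
        left_inv := fun t => by simp
        right_inv := fun y => by simp }
    rw [← φ.sum_comp, Fintype.sum_prod_type]
    have h2 : ∀ v : F, ∀ e : F × F, channelU (qSC F p) x (φ (v, e)) *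
        ∑ α, app (channelU (qSC F p)) (φ (v, e)) α ^ 2 =
        1 / (Fintype.card F : ℝ) * (noise F p e * ∑ a, postU F p e a ^ 2) := fun v e => by
      simp only [φ, Equiv.coe_fn_mk, app_channelU_eq_postU]
      have h3 : ∑ α, postU F p e (α - x) ^ 2 = ∑ a, postU F p e a ^ 2 :=
        (Equiv.subRight x).sum_comp (fun a => postU F p e a ^ 2)
      rw [h3, ← mul_assoc]
      congr 1
      rw [channelU, qSC_eq_zero_sub, qSC_eq_zero_sub (x + v), noise]
      congr 3 <;> ring
    simp only [h2, ← Finset.mul_sum]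
    simp
  simp only [kvCapacity, h1]
  simp

/-- The a posteriori probability of the true symbol and the squared norm of the vector of the
a posteriori probabilities have the same mean. -/
theorem sum_noise_mul_sum_postU_sq (F : Type) [Field F] [Fintype F] (p : ℝ) :
    ∑ e, noise F p e * ∑ a, postU F p e a ^ 2 = ∑ e, noise F p e * postU F p e 0 := by
  have := two_le_card F
  let w : F → F × F → ℝ := fun a e => qSC F p 0 (e.1 - a) * qSC F p 0 (e.2 - a)
  let S : F × F → ℝ := fun e => diffProb F p (e.2 - e.1)
  have hS : ∀ (e : F × F) (b : F), S (e - (b, b)) = S e := fun e b => by simp [S]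
  have hw : ∀ (e : F × F) (a b : F), w a (e - (b, b)) = w (a + b) e := fun e a b => by
    simp only [w, Prod.fst_sub, Prod.snd_sub]
    congr 2 <;> ring
  have hsum : ∀ e, ∑ a, w a e = S e := fun e => by
    simp only [w, S]
    rw [← sum_qSC_mul_shift, ← (Equiv.subLeft e.1).sum_comp]
    refine Finset.sum_congr rfl fun u _ => ?_
    simp only [Equiv.subLeft_apply]
    congr 2 <;> ring
  have hpost : ∀ e a, postU F p e a = w a e / S e := fun e a => postU_eq e a
  have hnoise : ∀ e, noise F p e = w 0 e := fun e => by simp [w, noise]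
  -- Translating both received symbols by b turns the input b into the input 0, so either mean may
  -- be averaged over all inputs.
  have h1 : ∀ b : F, ∑ e, w b e * ∑ a, (w a e / S e) ^ 2 =
      ∑ e, w 0 e * ∑ a, (w a e / S e) ^ 2 := fun b => by
    rw [← (Equiv.subRight (b, b)).sum_comp (fun e => w 0 e * ∑ a, (w a e / S e) ^ 2)]
    refine Finset.sum_congr rfl fun e _ => ?_
    simp only [Equiv.subRight_apply, hS, hw, zero_add]
    congr 1
    exact (Equiv.sum_comp (Equiv.addRight b) fun a => (w a e / S e) ^ 2).symm
  have h2 : ∀ b : F, ∑ e, w b e * (w b e / S e) = ∑ e, w 0 e * (w 0 e / S e) := fun b => by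
    rw [← (Equiv.subRight (b, b)).sum_comp (fun e => w 0 e * (w 0 e / S e))]
    refine Finset.sum_congr rfl fun e _ => ?_
    simp only [Equiv.subRight_apply, hS, hw, zero_add]
  -- After summation over the input, both sides are the sum of w²/S over all inputs and outputs.
  -- Outputs with S = 0 contribute 0 to both by the division convention.
  have h3 : ∑ b, ∑ e, w b e * ∑ a, (w a e / S e) ^ 2 = ∑ b, ∑ e, w b e * (w b e / S e) := by
    rw [Finset.sum_comm, Finset.sum_comm (s := (Finset.univ : Finset F))]
    refine Finset.sum_congr rfl fun e _ => ?_
    rw [← Finset.sum_mul, hsum, Finset.mul_sum]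
    refine Finset.sum_congr rfl fun a _ => ?_
    by_cases hz : S e = 0
    · simp [hz]
    · field_simp
  simp only [h1, h2, Finset.sum_const, Finset.card_univ, nsmul_eq_mul] at h3
  simp only [hpost, hnoise]
  exact mul_left_cancel₀ (by positivity) h3

theorem sum_noise_mul_sum_postV_sq (F : Type) [Field F] [Fintype F] (p : ℝ) :
    ∑ e, noise F p e * ∑ a, postV F p e a ^ 2 = ∑ b, diffProb F p b ^ 2 := by
  simp only [postV, sum_app_channelV_sq]
  rw [← Finset.sum_mul, sum_noise, one_mul]

theorem sum_noise_mul_postV (F : Type) [Field F] [Fintype F] (p : ℝ) :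
    ∑ e, noise F p e * postV F p e 0 = ∑ b, diffProb F p b ^ 2 := by
  simp only [postV_eq, sub_zero]
  rw [sum_noise_mul (diffProb F p)]
  exact Finset.sum_congr rfl fun b _ => by ring

/-- The Koetter-Vardy capacity of `channelU` for the symmetric channel with `q` symbols. -/
noncomputable def capU (p q : ℝ) : ℝ :=
  let r := p / (q - 1)
  let d := 1 - p - r
  let A := d ^ 2 + r * (1 + d)
  let B := r * (1 + d)
  ((1 - p) ^ 2 + p * r) ^ 2 * B⁻¹ + ((1 - p) ^ 4 + p * r ^ 3) * (A⁻¹ - B⁻¹)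

theorem sum_qSC_pow (F : Type) [Field F] [Fintype F] (p : ℝ) (j : ℕ) :
    ∑ u, qSC F p 0 u ^ (j + 1) = (1 - p) ^ (j + 1) + p * crossProb F p ^ j := by
  classical
  have h1 : ∀ u : F, qSC F p 0 u ^ (j + 1) = crossProb F p ^ (j + 1) +
      if u = 0 then (1 - p) ^ (j + 1) - crossProb F p ^ (j + 1) else 0 := fun u => by
    rw [qSC, ← crossProb]
    split_ifs <;> ring
  simp only [h1, Finset.sum_add_distrib, Finset.sum_ite_eq', Finset.mem_univ, if_true,
    Finset.sum_const, Finset.card_univ, nsmul_eq_mul]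
  have h2 := card_sub_one_mul_crossProb F p
  linear_combination crossProb F p ^ j * h2

theorem sum_noise_mul_postU (F : Type) [Field F] [Fintype F] (p : ℝ) :
    ∑ e, noise F p e * postU F p e 0 = capU p (Fintype.card F) := by
  classical
  set w : F → ℝ := qSC F p 0 with hw
  set A := diffProb F p 0 with hA
  set B := crossProb F p * (1 + excess F p) with hB
  -- The denominator is A on the diagonal and B off it; writing every term with B and correcting the
  -- diagonal makes the double sum factor.
  have h1 : ∀ e : F × F, noise F p e * postU F p e 0 = w e.1 ^ 2 * (w e.2 ^ 2 * B⁻¹) +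
      if e.1 = e.2 then w e.1 ^ 4 * (A⁻¹ - B⁻¹) else 0 := fun e => by
    rw [postU_eq, noise]
    simp only [sub_zero]
    by_cases h : e.1 = e.2
    · rw [if_pos h, h, sub_self, ← hA, ← hw]
      ring
    · rw [if_neg h, diffProb_of_ne_zero (sub_ne_zero.2 (Ne.symm h)), ← hw, ← hB]
      ring
  rw [Finset.sum_congr rfl fun e _ => h1 e, Finset.sum_add_distrib, Fintype.sum_prod_type,
    Fintype.sum_prod_type]
  simp only [← Finset.mul_sum, ← Finset.sum_mul, Finset.sum_ite_eq, Finset.mem_univ, if_true]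
  rw [hw, sum_qSC_pow F p 1, sum_qSC_pow F p 3, hA, diffProb_zero, ← hB, capU, hB, excess,
    crossProb]
  ring

end Channel

open Classical in
theorem errorProb_eq_sum {F Y κ J : Type} [Fintype Y] [Fintype κ] [Fintype J] (φ : J ≃ (κ → Y))
    (W : F → Y → ℝ) (dec : (κ → Y) → Option (κ → F)) (c : κ → F) :
    errorProb W dec c = ∑ e : J, if dec (φ e) = some c then 0 else ∏ j, W (c j) (φ e j) :=
  (φ.sum_comp fun y => if dec y = some c then 0 else ∏ j, W (c j) (y j)).symm

section Channel

variable {F : Type} [Field F] [Fintype F] {p : ℝ}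

/-! ### The capacities for large alphabets. -/

theorem abs_sum_diffProb_sq_sub_le (hp : p ∈ Set.Icc (0 : ℝ) 1) :
    |∑ b, diffProb F p b ^ 2 - (1 - p) ^ 4| ≤ 9 / (Fintype.card F : ℝ) := by
  have hq := two_le_card F
  rw [sum_diffProb_sq]
  have hd := excess_sq_le_one (F := F) hp
  have hr0 := crossProb_nonneg (F := F) hp
  have hr2 := crossProb_le_two_div (F := F) hp
  set d := excess F p with hdef
  set r := crossProb F p
  have hd' : d = 1 - p - r := rfl
  set a := 1 - p with ha
  have ha0 : 0 ≤ a := by rw [ha]; linarith [hp.2]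
  have ha1 : a ≤ 1 := by rw [ha]; linarith [hp.1]
  have hd1 := abs_le.1 ((sq_le_one_iff_abs_le_one d).1 hd)
  have h1 : |d ^ 4 - a ^ 4| ≤ 4 * r := by
    have : d ^ 4 - a ^ 4 = -r * ((d + a) * (d ^ 2 + a ^ 2)) := by
      linear_combination ((d + a) * (d ^ 2 + a ^ 2)) * hd'
    have h2 : |(d + a) * (d ^ 2 + a ^ 2)| ≤ 2 * 2 := by
      rw [abs_mul]
      refine mul_le_mul ?_ ?_ (abs_nonneg _) (by norm_num)
      · rw [abs_le]; constructor <;> linarith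
      · rw [abs_of_nonneg (by positivity)]; nlinarith
    rw [this, abs_mul, abs_neg, abs_of_nonneg hr0]
    nlinarith
  have h3 : |(1 - d ^ 4) / (Fintype.card F : ℝ)| ≤ 1 / (Fintype.card F : ℝ) := by
    have h4 : d ^ 4 ≤ 1 := by nlinarith [sq_nonneg d]
    have h5 : 0 ≤ d ^ 4 := by positivity
    rw [abs_of_nonneg (div_nonneg (by linarith) (by linarith))]
    exact div_le_div_of_nonneg_right (by linarith) (by linarith)
  calc |d ^ 4 + (1 - d ^ 4) / (Fintype.card F : ℝ) - a ^ 4|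
      = |(d ^ 4 - a ^ 4) + (1 - d ^ 4) / (Fintype.card F : ℝ)| := by congr 1; ring
    _ ≤ 4 * r + 1 / (Fintype.card F : ℝ) := (abs_add_le _ _).trans (add_le_add h1 h3)
    _ ≤ 4 * (2 / (Fintype.card F : ℝ)) + 1 / (Fintype.card F : ℝ) := by linarith
    _ = 9 / (Fintype.card F : ℝ) := by ring

/-- Equal noise symbols contribute (1 - p)² in the limit, unequal ones 2p(1 - p)²/(2 - p). The
latter come from exactly one correct symbol: probability about 2p(1 - p), posterior about (1 - p)/(2
- p). The condition q ≥ 3 keeps 2 - p - r at least 1/2. -/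
theorem abs_capU_sub_le (hp : p ∈ Set.Icc (0 : ℝ) 1) {q : ℝ} (hq : 3 ≤ q) :
    |capU p q - (p + 2) * (p - 1) ^ 2 / (2 - p)| ≤ 20 / q := by
  -- For p = 0 the off-diagonal denominator is zero; the convention 0⁻¹ = 0 gives the correct value
  -- 1.
  rcases hp.1.eq_or_lt with rfl | hp0
  · have : (0 : ℝ) ≤ 20 / q := div_nonneg (by norm_num) (by linarith)
    norm_num [capU]
    linarith
  have hp1 := hp.2
  obtain ⟨r, hrdef⟩ : ∃ r, r = p / (q - 1) := ⟨_, rfl⟩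
  have hr : r * (q - 1) = p := by rw [hrdef, div_mul_cancel₀]; linarith
  have hr0 : 0 < r := by rw [hrdef]; exact div_pos hp0 (by linarith)
  have hr1 : r ≤ 1 / 2 := by nlinarith
  have hrq : r ≤ 2 / q := by rw [le_div_iff₀ (by linarith)]; nlinarith
  obtain ⟨a, ha⟩ : ∃ a, a = 1 - p := ⟨_, rfl⟩
  have ha0 : 0 ≤ a := by linarith
  have ha1 : a ≤ 1 := by linarith
  have hA : 0 < a ^ 2 + p * r := by positivity
  have hB : 0 < 2 - p - r := by linarith
  have e1 : capU p q = (a ^ 4 + p * r ^ 3) / (a ^ 2 + p * r) +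
      p * (2 * a ^ 2 + p * r - r ^ 2) / (2 - p - r) := by
    have h1 : (1 - p - r) ^ 2 + r * (1 + (1 - p - r)) = a ^ 2 + p * r := by rw [ha]; ring
    have h2 : r * (1 + (1 - p - r)) = r * (2 - p - r) := by ring
    simp only [capU]
    rw [← hrdef, h1, h2, ← ha]
    field_simp
    ring
  have h1 : |(a ^ 4 + p * r ^ 3) / (a ^ 2 + p * r) - a ^ 2| ≤ 2 * r := by
    have : (a ^ 4 + p * r ^ 3) / (a ^ 2 + p * r) - a ^ 2 =
        (p * r ^ 3 - a ^ 2 * (p * r)) / (a ^ 2 + p * r) := by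
      field_simp
      ring
    rw [this, abs_div, abs_of_pos hA, div_le_iff₀ hA, abs_le]
    have hpr : 0 < p * r := by positivity
    constructor
    · nlinarith [mul_nonneg (sq_nonneg a) hr0.le, mul_pos hpr (sq_pos_of_pos hr0),
        mul_nonneg (mul_nonneg (sq_nonneg a) hr0.le) (by linarith : 0 ≤ 1 - p), mul_pos hpr hr0]
    · nlinarith [mul_nonneg (sq_nonneg a) hr0.le, mul_nonneg (sq_nonneg a) hpr.le,
        mul_nonneg (mul_pos hpr hr0).le (by linarith : 0 ≤ 2 - r)]
  have h2 : |p * (2 * a ^ 2 + p * r - r ^ 2) / (2 - p - r) - 2 * p * a ^ 2 / (2 - p)| ≤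
      8 * r := by
    have : p * (2 * a ^ 2 + p * r - r ^ 2) / (2 - p - r) - 2 * p * a ^ 2 / (2 - p) =
        p * r * ((p - r) * (2 - p) + 2 * a ^ 2) / ((2 - p - r) * (2 - p)) := by
      rw [div_sub_div _ _ hB.ne' (by linarith)]
      congr 1
      ring
    have hD : 1 / 2 ≤ (2 - p - r) * (2 - p) := by nlinarith
    rw [this, abs_div, abs_of_pos (by linarith : 0 < (2 - p - r) * (2 - p)),
      div_le_iff₀ (by linarith)]
    have hm : |(p - r) * (2 - p) + 2 * a ^ 2| ≤ 4 := by
      have hrp : r ≤ p := by nlinarith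
      rw [abs_le]
      constructor <;> nlinarith [mul_nonneg (sub_nonneg.2 hrp) (by linarith : 0 ≤ 2 - p)]
    rw [abs_mul, abs_of_pos (by positivity : 0 < p * r)]
    calc p * r * |(p - r) * (2 - p) + 2 * a ^ 2| ≤ (1 * r) * 4 := by gcongr
      _ = 8 * r * (1 / 2) := by ring
      _ ≤ _ := by gcongr
  have e2 : (p + 2) * (p - 1) ^ 2 / (2 - p) = a ^ 2 + 2 * p * a ^ 2 / (2 - p) := by
    have : (2 - p) ≠ 0 := by linarith
    rw [ha]
    field_simp
    ring
  rw [e1, e2, show ∀ s t u v : ℝ, s + t - (u + v) = (s - u) + (t - v) from fun _ _ _ _ => by ring]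
  calc _ ≤ 2 * r + 8 * r := (abs_add_le _ _).trans (add_le_add h1 h2)
    _ ≤ 10 * (2 / q) := by linarith
    _ = 20 / q := by ring

/-! ### Candidate symbols: all others have small posterior, and a given wrong one is rarely a
candidate. -/

theorem crossProb_mul_one_add_excess_le (hp : p ∈ Set.Icc (0 : ℝ) 1) :
    crossProb F p * (1 + excess F p) ≤ 2 / ((Fintype.card F : ℝ) - 1) := by
  have hq := two_le_card F
  have h1 := crossProb_le (F := F) hp
  have h2 := (abs_le.1 ((sq_le_one_iff_abs_le_one _).1 (excess_sq_le_one (F := F) hp))).2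
  have h0 := crossProb_nonneg (F := F) hp
  calc crossProb F p * (1 + excess F p) ≤ crossProb F p * 2 := by gcongr; linarith
    _ ≤ 1 / ((Fintype.card F : ℝ) - 1) * 2 := by gcongr
    _ = 2 / ((Fintype.card F : ℝ) - 1) := by ring

theorem postV_nonneg (hp : p ∈ Set.Icc (0 : ℝ) 1) (e : F × F) (a : F) : 0 ≤ postV F p e a := by
  rw [postV_eq]; exact diffProb_nonneg hp _

theorem sum_postV_le (e : F × F) : ∑ a, postV F p e a ≤ 1 := by
  simp only [postV_eq]
  rw [← sum_diffProb F p]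
  exact ((Equiv.subLeft (e.2 - e.1)).sum_comp (diffProb F p)).le

theorem postV_le (hp : p ∈ Set.Icc (0 : ℝ) 1) {e : F × F} {a : F} (h : ¬ a = e.2 - e.1) :
    postV F p e a ≤ 2 / ((Fintype.card F : ℝ) - 1) := by
  rw [postV_eq, diffProb_of_ne_zero (sub_ne_zero.2 (Ne.symm h))]
  exact crossProb_mul_one_add_excess_le hp

theorem sum_noise_candV_le [DecidableEq F] (hp : p ∈ Set.Icc (0 : ℝ) 1) {a : F} (ha : a ≠ 0) :
    ∑ e : F × F, (if a = e.2 - e.1 then noise F p e else 0) ≤ 2 / ((Fintype.card F : ℝ) - 1) := by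
  have h1 := sum_noise_mul (p := p) fun b : F => if a = b then (1 : ℝ) else 0
  simp only [mul_ite, mul_one, mul_zero, Finset.sum_ite_eq, Finset.mem_univ, if_true] at h1
  rw [h1, diffProb_of_ne_zero ha]
  exact crossProb_mul_one_add_excess_le hp

theorem postU_nonneg (hp : p ∈ Set.Icc (0 : ℝ) 1) (e : F × F) (a : F) : 0 ≤ postU F p e a := by
  rw [postU_eq]
  exact div_nonneg (mul_nonneg (qSC_nonneg hp _ _) (qSC_nonneg hp _ _)) (diffProb_nonneg hp _)

theorem sum_postU_le (e : F × F) : ∑ a, postU F p e a ≤ 1 := by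
  simp only [postU, app]
  rw [← Finset.sum_div]
  exact div_self_le_one _

theorem qSC_zero_of_ne {a : F} (ha : a ≠ 0) : qSC F p 0 a = crossProb F p := by
  rw [qSC, if_neg ha, crossProb]

theorem crossProb_mul_le_diffProb (b : F) :
    crossProb F p * (1 + excess F p) ≤ diffProb F p b := by
  by_cases hb : b = 0
  · rw [hb, diffProb_zero]
    linarith [sq_nonneg (excess F p)]
  · rw [diffProb_of_ne_zero hb]

/-- For a symbol that explains neither received symbol the numerator is r², while the denominator is
at least r(1 + d) ≥ r/2. -/
theorem postU_le (hp : p ∈ Set.Icc (0 : ℝ) 1) (hq : (3 : ℝ) ≤ Fintype.card F) {e : F × F} {a : F}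
    (h : ¬ (a = e.1 ∨ a = e.2)) : postU F p e a ≤ 2 / ((Fintype.card F : ℝ) - 1) := by
  push Not at h
  have h0 : 0 ≤ 2 / ((Fintype.card F : ℝ) - 1) := div_nonneg (by norm_num) (by linarith)
  rw [postU_eq, qSC_zero_of_ne (sub_ne_zero.2 h.1.symm), qSC_zero_of_ne (sub_ne_zero.2 h.2.symm)]
  have hr := crossProb_le (F := F) hp
  have hle := crossProb_mul_le_diffProb (p := p) (e.2 - e.1)
  rcases (crossProb_nonneg (F := F) hp).eq_or_lt with hr0 | hr0
  · rw [← hr0]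
    simpa using h0
  have hr2 : crossProb F p ≤ 1 / 2 :=
    hr.trans (one_div_le_one_div_of_le (by norm_num) (by linarith))
  have hd : 1 / 2 ≤ 1 + excess F p := by
    rw [excess]
    linarith [hp.2]
  have h1 : crossProb F p * (1 / 2) ≤ diffProb F p (e.2 - e.1) :=
    le_trans (by gcongr) hle
  rw [div_le_iff₀ (lt_of_lt_of_le (by positivity) h1)]
  calc crossProb F p * crossProb F p ≤ 1 / ((Fintype.card F : ℝ) - 1) * crossProb F p := by gcongr
    _ = 2 / ((Fintype.card F : ℝ) - 1) * (crossProb F p * (1 / 2)) := by ring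
    _ ≤ _ := by gcongr

theorem sum_noise_candU_le [DecidableEq F] (hp : p ∈ Set.Icc (0 : ℝ) 1) {a : F} (ha : a ≠ 0) :
    ∑ e : F × F, (if a = e.1 ∨ a = e.2 then noise F p e else 0) ≤
      2 / ((Fintype.card F : ℝ) - 1) := by
  have h1 : ∑ e : F × F, (if a = e.1 then noise F p e else 0) = crossProb F p := by
    have : ∀ u v : F, (if a = u then noise F p (u, v) else 0) =
        (if a = u then qSC F p 0 u else 0) * qSC F p 0 v := fun u v => by
      split_ifs <;> simp [noise]
    rw [Fintype.sum_prod_type]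
    simp only [this, ← Finset.mul_sum, sum_qSC_zero, mul_one, Finset.sum_ite_eq, Finset.mem_univ,
      if_true]
    exact qSC_zero_of_ne ha
  have h2 : ∑ e : F × F, (if a = e.2 then noise F p e else 0) = crossProb F p := by
    have : ∀ u v : F, (if a = v then noise F p (u, v) else 0) =
        qSC F p 0 u * (if a = v then qSC F p 0 v else 0) := fun u v => by
      split_ifs <;> simp [noise]
    rw [Fintype.sum_prod_type]
    simp only [this, ← Finset.mul_sum, ← Finset.sum_mul, sum_qSC_zero, one_mul, Finset.sum_ite_eq,
      Finset.mem_univ, if_true]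
    exact qSC_zero_of_ne ha
  calc _ ≤ ∑ e : F × F, ((if a = e.1 then noise F p e else 0) +
          (if a = e.2 then noise F p e else 0)) := by
        refine Finset.sum_le_sum fun e _ => ?_
        have := noise_nonneg hp e
        by_cases h1 : a = e.1 <;> by_cases h2 : a = e.2 <;> simp [h1, h2] <;> simp_all
    _ = 2 * crossProb F p := by rw [Finset.sum_add_distrib, h1, h2]; ring
    _ ≤ 2 * (1 / ((Fintype.card F : ℝ) - 1)) := by linarith [crossProb_le (F := F) hp]
    _ = 2 / ((Fintype.card F : ℝ) - 1) := by ring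

/-! ### The error probability of the `(U | U + V)` decoder -/

/-- Subtracting the sent word makes the noise the variable of summation. When V is decoded
correctly, the decoder of U receives the posteriors computed from the true v; hence a failure forces
one of two failures with correct side information, both expressed in the same noise. The union bound
needs no independence between them. -/
theorem errorProb_uvDecode_le {ι : Type} [Fintype ι] (hp : p ∈ Set.Icc (0 : ℝ) 1) (x : ι → F)
    (k₀ k₁ s₀ s₁ : ℕ) (u v : ι → F) :
    errorProb (qSC F p) (uvDecode (qSC F p) x k₀ k₁ s₀ s₁) (Sum.elim u (u + v)) ≤
      prodProb (noise F p)
        (fun e => kvDecode x k₁ s₁ (fun i a => postV F p (e i) (a - v i)) ≠ some v) +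
      prodProb (noise F p)
        (fun e => kvDecode x k₀ s₀ (fun i a => postU F p (e i) (a - u i)) ≠ some u) := by
  classical
  refine le_trans ?_ (prodProb_or_le (noise_nonneg hp) _ _)
  let φ : (ι → F × F) ≃ (ι ⊕ ι → F) :=
    { toFun := fun e => Sum.elim (fun i => (e i).1 + u i) (fun i => (e i).2 + (u i + v i))
      invFun := fun y i => (y (Sum.inl i) - u i, y (Sum.inr i) - (u i + v i))
      left_inv := fun e => by ext i <;> simp
      right_inv := fun y => by ext (i | i) <;> simp }
  rw [errorProb_eq_sum φ, prodProb]
  refine Finset.sum_le_sum fun e _ => ?_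
  have hprod : ∏ j, qSC F p (Sum.elim u (u + v) j) (φ e j) = ∏ i, noise F p (e i) := by
    rw [Fintype.prod_sum_type, ← Finset.prod_mul_distrib]
    refine Finset.prod_congr rfl fun i _ => ?_
    simp only [φ, Equiv.coe_fn_mk, Sum.elim_inl, Sum.elim_inr, Pi.add_apply, noise]
    rw [qSC_eq_zero_sub, qSC_eq_zero_sub (u i + v i), add_sub_cancel_right, add_sub_cancel_right]
  rw [hprod]
  have hnn : 0 ≤ ∏ i, noise F p (e i) := Finset.prod_nonneg fun i _ => noise_nonneg hp _
  by_cases hV : kvDecode x k₁ s₁ (fun i a => postV F p (e i) (a - v i)) = some v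
  swap
  · rw [if_pos (Or.inl hV)]
    split_ifs
    · exact hnn
    · rfl
  by_cases hU : kvDecode x k₀ s₀ (fun i a => postU F p (e i) (a - u i)) = some u
  swap
  · rw [if_pos (Or.inr hU)]
    split_ifs
    · exact hnn
    · rfl
  have hdec : uvDecode (qSC F p) x k₀ k₁ s₀ s₁ (φ e) = some (Sum.elim u (u + v)) := by
    have e1 : (fun i => app (channelV (qSC F p)) (φ e (Sum.inl i), φ e (Sum.inr i))) =
        fun i a => postV F p (e i) (a - v i) := by
      funext i a
      exact app_channelV_eq_postV (e i) (u i) (v i) a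
    have e2 : (fun i => app (channelU (qSC F p)) (φ e (Sum.inl i), φ e (Sum.inr i), v i)) =
        fun i a => postU F p (e i) (a - u i) := by
      funext i a
      exact app_channelU_eq_postU (e i) (u i) (v i) a
    rw [uvDecode, e1, hV, Option.bind_some, e2, hU, Option.map_some]
  rw [if_pos hdec]
  split_ifs
  · exact hnn
  · rfl

theorem maxErrorProb_uvDecode_le {ι : Type} [Fintype ι] (hp : p ∈ Set.Icc (0 : ℝ) 1) {x : ι → F}
    {k₀ k₁ s₀ s₁ : ℕ} {B₀ B₁ : ℝ}
    (h₁ : ∀ v ∈ rsCode x k₁, prodProb (noise F p)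
      (fun e => kvDecode x k₁ s₁ (fun i a => postV F p (e i) (a - v i)) ≠ some v) ≤ B₁)
    (h₀ : ∀ u ∈ rsCode x k₀, prodProb (noise F p)
      (fun e => kvDecode x k₀ s₀ (fun i a => postU F p (e i) (a - u i)) ≠ some u) ≤ B₀) :
    maxErrorProb (qSC F p) (uvCode (rsCode x k₀) (rsCode x k₁))
      (uvDecode (qSC F p) x k₀ k₁ s₀ s₁) ≤ B₁ + B₀ := by
  refine ciSup_le fun c => ?_
  obtain ⟨_, u, hu, v, hv, rfl⟩ := c
  exact (errorProb_uvDecode_le hp x k₀ k₁ s₀ s₁ u v).trans (add_le_add (h₁ v hv) (h₀ u hu))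

theorem maxErrorProb_nonneg {κ : Type} [Fintype κ] (hp : p ∈ Set.Icc (0 : ℝ) 1)
    (C : Submodule F (κ → F)) (dec : (κ → F) → Option (κ → F)) :
    0 ≤ maxErrorProb (qSC F p) C dec := by
  refine Real.iSup_nonneg fun c => Finset.sum_nonneg fun y _ => ?_
  split_ifs
  · rfl
  · exact Finset.prod_nonneg fun j _ => qSC_nonneg hp _ _

end Channel

/-! ### The rate -/

theorem finrank_rsCode {F ι : Type} [Field F] [Fintype ι] {x : ι → F}
    (hx : Function.Injective x) {k : ℕ} (hk : k ≤ Fintype.card ι) :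
    Module.finrank F (rsCode x k) = k := by
  rw [rsCode, ← LinearMap.range_domRestrict, LinearMap.finrank_range_of_inj, finrank_degreeLT]
  rw [← LinearMap.ker_eq_bot, LinearMap.ker_eq_bot']
  rintro ⟨f, hf⟩ h
  rw [mem_degreeLT] at hf
  have : f = 0 := eq_zero_of_degree_lt_of_eval_index_eq_zero Finset.univ hx.injOn
    (hf.trans_le (by exact_mod_cast hk)) fun i _ => congrFun h i
  exact Subtype.ext this

theorem finrank_uvCode {F ι : Type} [Field F] [Fintype ι] (U V : Submodule F (ι → F)) :
    Module.finrank F (uvCode U V) = Module.finrank F U + Module.finrank F V := by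
  let L : (U × V) →ₗ[F] uvCode U V :=
    { toFun := fun w => ⟨Sum.elim w.1 (w.1 + w.2), w.1, w.1.2, w.2, w.2.2, rfl⟩
      map_add' := fun w w' => by
        apply Subtype.ext
        funext j
        rcases j with i | i
        · simp
        · simp [add_add_add_comm]
      map_smul' := fun r w => by
        apply Subtype.ext
        funext j
        rcases j with i | i
        · simp
        · simp [mul_add] }
  have hL : Function.Bijective L := by
    constructor
    · rw [← LinearMap.ker_eq_bot, LinearMap.ker_eq_bot']
      rintro ⟨u, v⟩ h
      have h' : Sum.elim (u : ι → F) ((u : ι → F) + (v : ι → F)) = 0 := congrArg Subtype.val h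
      have hu : (u : ι → F) = 0 := funext fun i => congrFun h' (Sum.inl i)
      have hv : (v : ι → F) = 0 := funext fun i => by
        have := congrFun h' (Sum.inr i)
        simpa [hu] using this
      exact Prod.ext (Subtype.ext hu) (Subtype.ext hv)
    · rintro ⟨_, u, hu, v, hv, rfl⟩
      exact ⟨(⟨u, hu⟩, ⟨v, hv⟩), rfl⟩
  rw [← (LinearEquiv.ofBijective L hL).finrank_eq, Module.finrank_prod]

theorem codeRate_uvCode_rsCode {F ι : Type} [Field F] [Fintype ι] {x : ι → F}
    (hx : Function.Injective x) {k₀ k₁ : ℕ} (h₀ : k₀ ≤ Fintype.card ι) (h₁ : k₁ ≤ Fintype.card ι) :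
    codeRate (uvCode (rsCode x k₀) (rsCode x k₁)) = ((k₀ : ℝ) + k₁) / (2 * Fintype.card ι) := by
  rw [codeRate, finrank_uvCode, finrank_rsCode hx h₀, finrank_rsCode hx h₁, Fintype.card_sum]
  push_cast
  rw [two_mul]

/-! ### Choice of the parameters -/

/-- K is the limiting capacity and κ the actual one. The choice k = ⌈(K - 5δ)n⌉ absorbs the rounding
by 1 ≤ δn, the deviation of κ by another δn, and L = ⌊δn⌋. -/
theorem exists_dimension {K κ δ : ℝ} {n : ℕ} (hδ : 0 < δ) (hK : 6 * δ ≤ K) (hK1 : K ≤ 1)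
    (hκ : K - δ ≤ κ) (hn : 1 ≤ δ * n) : ∃ k : ℕ, 1 ≤ k ∧ k ≤ n ∧ (K - 5 * δ) * n ≤ k ∧
      (k : ℝ) ≤ (κ - 3 * δ) * n ∧ (k : ℝ) + ⌊δ * n⌋₊ ≤ (κ - 2 * δ) * n := by
  have hn0 : (0 : ℝ) < n := by
    by_contra h
    nlinarith
  have hpos : 0 < (K - 5 * δ) * n := mul_pos (by linarith) hn0
  have h1 := Nat.ceil_lt_add_one hpos.le
  have h2 := Nat.floor_le (by positivity : 0 ≤ δ * n)
  have h3 : (K - δ) * n ≤ κ * n := by gcongr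
  have h4 : K * n ≤ 1 * n := by gcongr
  refine ⟨⌈(K - 5 * δ) * n⌉₊, Nat.ceil_pos.2 hpos, ?_, Nat.le_ceil _, by linarith, by linarith⟩
  have : (⌈(K - 5 * δ) * n⌉₊ : ℝ) ≤ n := by linarith
  exact_mod_cast this

theorem tendsto_errorBound {δ : ℝ} (hδ : 0 < δ) :
    Tendsto (fun q : ℕ => 2 * (2 * Real.exp (-(δ ^ 2 / 4) * q) + (1 / 2) ^ ⌊δ * q⌋₊))
      atTop (𝓝 0) := by
  have h1 : Tendsto (fun q : ℕ => Real.exp (-(δ ^ 2 / 4) * q)) atTop (𝓝 0) := by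
    refine Real.tendsto_exp_atBot.comp ?_
    exact tendsto_natCast_atTop_atTop.const_mul_atTop_of_neg
      (by have : 0 < δ ^ 2 := by positivity
          linarith)
  have h2 : Tendsto (fun q : ℕ => ((1 : ℝ) / 2) ^ ⌊δ * (q : ℝ)⌋₊) atTop (𝓝 0) := by
    refine (tendsto_pow_atTop_nhds_zero_of_lt_one (by norm_num) (by norm_num)).comp ?_
    exact tendsto_nat_floor_atTop.comp (tendsto_natCast_atTop_atTop.const_mul_atTop hδ)
  simpa using ((h1.const_mul 2).add h2).const_mul 2

/-- The base 2/(q - 1) tends to 0 while the exponent stays proportional to q, which defeats any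
fixed exponential 12^q. -/
theorem eventually_pow_mul_pow_le {δ : ℝ} (hδ : 0 < δ) :
    ∀ᶠ q : ℕ in atTop, (12 : ℝ) ^ q * (2 / ((q : ℝ) - 1)) ^ ⌊δ * q⌋₊ ≤ (1 / 2) ^ ⌊δ * q⌋₊ := by
  -- Since ⌊t⌋ ≥ t/2 for t ≥ 2, this N gives q ≤ N⌊δq⌋, so 12^q is absorbed as (12^N)^⌊δq⌋.
  obtain ⟨N, hN⟩ := exists_nat_ge (2 / δ)
  rw [div_le_iff₀ hδ] at hN
  filter_upwards [eventually_ge_atTop N, tendsto_natCast_atTop_atTop.eventually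
    (eventually_ge_atTop ((12 : ℝ) ^ N * 4 + 1))] with q hq hq2
  have hpow : (0 : ℝ) < 12 ^ N := by positivity
  have hNq : (N : ℝ) ≤ q := by exact_mod_cast hq
  have h1 : q ≤ N * ⌊δ * q⌋₊ := by
    have h2 := Nat.lt_floor_add_one (δ * q)
    have h3 : (2 : ℝ) ≤ δ * q := hN.trans (by rw [mul_comm]; gcongr)
    have h4 : δ * q / 2 ≤ ⌊δ * q⌋₊ := by linarith
    have h5 : (q : ℝ) ≤ N * ⌊δ * q⌋₊ := by
      calc (q : ℝ) = 2 * q / 2 := by ring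
        _ ≤ (N * δ) * q / 2 := by gcongr
        _ = N * (δ * q / 2) := by ring
        _ ≤ _ := by gcongr
    exact_mod_cast h5
  have hq1 : (0 : ℝ) < (q : ℝ) - 1 := by linarith
  calc (12 : ℝ) ^ q * (2 / ((q : ℝ) - 1)) ^ ⌊δ * q⌋₊
      ≤ 12 ^ (N * ⌊δ * q⌋₊) * (2 / ((q : ℝ) - 1)) ^ ⌊δ * q⌋₊ := by
        gcongr
        norm_num
    _ = (12 ^ N * (2 / ((q : ℝ) - 1))) ^ ⌊δ * q⌋₊ := by rw [pow_mul, mul_pow]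
    _ ≤ (1 / 2) ^ ⌊δ * q⌋₊ := by
        gcongr
        rw [← mul_div_assoc, div_le_iff₀ hq1]
        linarith

/-- The properties of the codes of length and alphabet size `q` that are asked for. -/
def HasGoodCode (p R ε : ℝ) {F : Type} [Field F] [Fintype F] {q : ℕ} (x : Fin q → F)
    (k₀ k₁ s₀ s₁ : ℕ) : Prop :=
  (k₀ ≤ q ∧ k₁ ≤ q) ∧ (p < 1 → 1 ≤ k₀ ∧ 1 ≤ k₁) ∧
    R ≤ codeRate (uvCode (rsCode x k₀) (rsCode x k₁)) ∧
    maxErrorProb (qSC F p) (uvCode (rsCode x k₀) (rsCode x k₁))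
      (uvDecode (qSC F p) x k₀ k₁ s₀ s₁) ≤ ε

theorem exists_hasGoodCode_of_lt_one {p : ℝ} (hp : p ∈ Set.Icc (0 : ℝ) 1) (hp1 : p < 1) {R : ℝ}
    (hR : R < ((p + 2) * (p - 1) ^ 2 / (2 - p) + (1 - p) ^ 4) / 2) :
    ∃ b : ℕ → ℝ, Tendsto b atTop (𝓝 0) ∧ ∀ᶠ q : ℕ in atTop, ∀ (F : Type) [Field F] [Fintype F],
      Fintype.card F = q → ∀ x : Fin q → F, Function.Injective x →
        ∃ k₀ k₁ s₀ s₁, HasGoodCode p R (b q) x k₀ k₁ s₀ s₁ := by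
  have hp0 := hp.1
  set K₀ := (p + 2) * (p - 1) ^ 2 / (2 - p) with hK₀
  set K₁ := (1 - p) ^ 4 with hK₁
  have hK₀pos : 0 < K₀ := by
    have : 0 < (p - 1) ^ 2 := sq_pos_of_neg (by linarith)
    exact div_pos (by positivity) (by linarith)
  have hK₁pos : 0 < K₁ := by
    have : 0 < 1 - p := by linarith
    positivity
  have hK₀1 : K₀ ≤ 1 := by
    rw [hK₀, div_le_one (by linarith)]
    nlinarith [mul_nonneg hp0 hp0, mul_nonneg (mul_nonneg hp0 hp0) (sub_nonneg.2 hp.2),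
      mul_nonneg hp0 (sub_nonneg.2 hp.2)]
  have hK₁1 : K₁ ≤ 1 := pow_le_one₀ (by linarith) (by linarith)
  -- The first two bounds leave both dimensions positive; the third pays for the loss of 5δ in the
  -- rate. All are positive because p < 1.
  obtain ⟨δ, hδdef⟩ : ∃ δ, δ = min (min (K₀ / 6) (K₁ / 6)) (((K₀ + K₁) / 2 - R) / 5) := ⟨_, rfl⟩
  have hδ : 0 < δ := by
    rw [hδdef]
    exact lt_min (lt_min (by linarith) (by linarith)) (by linarith)
  have hδ₀ : 6 * δ ≤ K₀ := by
    have : δ ≤ K₀ / 6 := hδdef ▸ (min_le_left _ _).trans (min_le_left _ _)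
    linarith
  have hδ₁ : 6 * δ ≤ K₁ := by
    have : δ ≤ K₁ / 6 := hδdef ▸ (min_le_left _ _).trans (min_le_right _ _)
    linarith
  have hδR : R ≤ (K₀ + K₁) / 2 - 5 * δ := by
    have : δ ≤ ((K₀ + K₁) / 2 - R) / 5 := hδdef ▸ min_le_right _ _
    linarith
  refine ⟨_, tendsto_errorBound hδ, ?_⟩
  filter_upwards [eventually_pow_mul_pow_le hδ, eventually_ge_atTop 3,
    tendsto_natCast_atTop_atTop.eventually (eventually_ge_atTop (20 / δ)),
    tendsto_natCast_atTop_atTop.eventually (eventually_ge_atTop (2 / δ + 1))]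
    with q hpow hq3 hq20 hq2
  intro F _ _ hF x hx
  classical
  have hq3' : (3 : ℝ) ≤ q := by exact_mod_cast hq3
  have hqpos : (0 : ℝ) < q := by linarith
  have hqc : (3 : ℝ) ≤ Fintype.card F := by rw [hF]; exact hq3'
  have hne : Nonempty (Fin q) := ⟨⟨0, by omega⟩⟩
  rw [div_le_iff₀ hδ] at hq20
  have h20 : 20 / (q : ℝ) ≤ δ := by rw [div_le_iff₀ hqpos]; linarith
  have hρδ : 2 / ((Fintype.card F : ℝ) - 1) ≤ δ := by
    have : 2 / δ ≤ (q : ℝ) - 1 := by linarith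
    rw [div_le_iff₀ hδ] at this
    rw [hF, div_le_iff₀ (by linarith)]
    linarith
  have hκ₀ : K₀ - δ ≤ capU p (Fintype.card F) := by
    have := abs_le.1 (abs_capU_sub_le hp hqc)
    rw [← hK₀, hF] at this
    rw [hF]
    linarith [this.1]
  have hκ₁ : K₁ - δ ≤ ∑ b, diffProb F p b ^ 2 := by
    have := abs_le.1 (abs_sum_diffProb_sq_sub_le (F := F) hp)
    have h9 : 9 / (Fintype.card F : ℝ) ≤ 20 / q := by
      rw [hF]
      gcongr
      norm_num
    linarith [this.1]
  have hn : 1 ≤ δ * q := by linarith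
  obtain ⟨k₀, hk₀, hk₀q, hk₀K, hk₀κ, hk₀L⟩ := exists_dimension hδ hδ₀ hK₀1 hκ₀ hn
  obtain ⟨k₁, hk₁, hk₁q, hk₁K, hk₁κ, hk₁L⟩ := exists_dimension hδ hδ₁ hK₁1 hκ₁ hn
  have hρ : 0 ≤ 2 / ((Fintype.card F : ℝ) - 1) := div_nonneg (by norm_num) (by linarith)
  have hρ2 : 2 / ((Fintype.card F : ℝ) - 1) * ((Fintype.card F : ℝ) - 1) ≤ 2 :=
    (div_mul_cancel₀ _ (by linarith)).le
  have hδ2 : δ ≤ 2 := by linarith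
  rw [← Fintype.card_fin q] at hk₀κ hk₁κ hk₀L hk₁L
  obtain ⟨s₁, hs₁⟩ := (eventually_prodProb_kvDecode_le hx (noise_nonneg hp) (sum_noise F p)
    (postV_nonneg hp) sum_postV_le (sum_noise_mul_postV F p) (sum_noise_mul_sum_postV_sq F p)
    (cand := fun e a => a = e.2 - e.1) hρ hρ2 (fun a ha => sum_noise_candV_le hp ha) hδ hδ2
    (fun e a h => (postV_le hp h).trans hρδ) hk₁κ hk₁L).exists
  obtain ⟨s₀, hs₀⟩ := (eventually_prodProb_kvDecode_le hx (noise_nonneg hp) (sum_noise F p)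
    (postU_nonneg hp) sum_postU_le (sum_noise_mul_postU F p)
    ((sum_noise_mul_sum_postU_sq F p).trans (sum_noise_mul_postU F p))
    (cand := fun e a => a = e.1 ∨ a = e.2) hρ hρ2 (fun a ha => sum_noise_candU_le hp ha) hδ hδ2
    (fun e a h => (postU_le hp hqc h).trans hρδ) hk₀κ hk₀L).exists
  refine ⟨k₀, k₁, s₀, s₁, ⟨hk₀q, hk₁q⟩, fun _ => ⟨hk₀, hk₁⟩, ?_, ?_⟩
  · rw [codeRate_uvCode_rsCode hx (by simpa using hk₀q) (by simpa using hk₁q), Fintype.card_fin,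
      le_div_iff₀ (by linarith)]
    calc R * (2 * q) ≤ ((K₀ + K₁) / 2 - 5 * δ) * (2 * q) := by gcongr
      _ = (K₀ - 5 * δ) * q + (K₁ - 5 * δ) * q := by ring
      _ ≤ _ := add_le_add hk₀K hk₁K
  · refine (maxErrorProb_uvDecode_le hp hs₁ hs₀).trans ?_
    rw [Fintype.card_fin, hF]
    linarith

/-! ### The case p = 1. -/

/-- The zero code is decoded without errors if zero never has vanishing posterior probability. -/
theorem eventually_prodProb_kvDecode_zero {F E ι : Type} [Field F] [Fintype F] [Fintype E]
    [Fintype ι] [Nonempty ι] {x : ι → F} (hx : Function.Injective x) {μ : E → ℝ}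
    {π : E → F → ℝ} (hπ : ∀ e a, 0 ≤ π e a) (hpos : ∀ e, μ e ≠ 0 → 0 < π e 0) :
    ∀ᶠ s in atTop, ∀ c ∈ rsCode x 0,
      prodProb μ (fun e : ι → E => kvDecode x 0 s (fun i a => π (e i) (a - c i)) ≠ some c) ≤
        0 := by
  have hzero : ∀ c ∈ rsCode x 0, c = 0 := fun c hc =>
    eq_zero_of_mem_rsCode hx hc ∅ (Nat.zero_le _) (by simp)
  have hgood : ∀ e : ι → E, ∀ᶠ s in atTop, (∀ i, μ (e i) ≠ 0) →
      kvDecode x 0 s (fun i a => π (e i) (a - (0 : ι → F) i)) = some 0 := fun e => by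
    by_cases he : ∀ i, μ (e i) ≠ 0
    swap
    · exact Eventually.of_forall fun s h => absurd h he
    have hev : (fun i => (0 : F[X]).eval (x i)) = 0 := by simp [Pi.zero_def]
    have hscore : 0 < score (fun i a => π (e i) (a - (0 : ι → F) i))
        fun i => (0 : F[X]).eval (x i) := by
      refine Finset.sum_pos (fun i _ => ?_) Finset.univ_nonempty
      simpa using hpos _ (he i)
    -- With k = 0 the truncated weight k - 1 is 0, so the list criterion only asks for a positive
    -- score.
    filter_upwards [eventually_mem_kvList hx (k := 0) (fun i a => hπ _ _)
      (by rw [degree_zero]; exact WithBot.bot_lt_coe _) hscore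
      (by simpa using pow_pos hscore 2)] with s hs _
    rw [hev] at hs
    exact kvDecode_eq_some hs fun c' hc' hne => absurd (hzero c' hc') hne
  filter_upwards [eventually_all.2 hgood] with s hs c hc
  rw [hzero c hc]
  refine Finset.sum_nonpos fun e _ => ?_
  split_ifs with h
  · by_cases he : ∀ i, μ (e i) ≠ 0
    · exact absurd (hs e he) h
    · push Not at he
      obtain ⟨i, hi⟩ := he
      exact (Finset.prod_eq_zero (Finset.mem_univ i) hi).le
  · rfl

/-- Three symbols are needed: with two symbols and p = 1 every symbol is flipped, and a nonzero
difference has probability 0. -/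
theorem diffProb_one_pos {F : Type} [Field F] [Fintype F] (hF : (3 : ℝ) ≤ Fintype.card F)
    (b : F) : 0 < diffProb F 1 b := by
  refine lt_of_lt_of_le ?_ (crossProb_mul_le_diffProb b)
  have h0 : 0 < crossProb F 1 := div_pos one_pos (by linarith)
  have h1 : crossProb F 1 < 1 := by
    rw [crossProb, div_lt_one (by linarith)]
    linarith
  refine mul_pos h0 ?_
  rw [excess]
  linarith

/-- At p = 1 the rate bound is 0, so R is negative and the zero code has sufficient rate. -/
theorem exists_hasGoodCode_one {R : ℝ} (hR : R < 0) {F : Type} [Field F] [Fintype F]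
    (hF : (3 : ℝ) ≤ Fintype.card F) {q : ℕ} (hq : q ≠ 0) {x : Fin q → F}
    (hx : Function.Injective x) : ∃ k₀ k₁ s₀ s₁, HasGoodCode 1 R 0 x k₀ k₁ s₀ s₁ := by
  have hne : Nonempty (Fin q) := ⟨⟨0, by omega⟩⟩
  have hp : (1 : ℝ) ∈ Set.Icc (0 : ℝ) 1 := by simp
  obtain ⟨s₁, hs₁⟩ := (eventually_prodProb_kvDecode_zero hx (μ := noise F 1) (postV_nonneg hp)
    fun e _ => by rw [postV_eq]; exact diffProb_one_pos hF _).exists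
  obtain ⟨s₀, hs₀⟩ := (eventually_prodProb_kvDecode_zero hx (μ := noise F 1) (postU_nonneg hp)
    fun e he => by
      rw [postU_eq, sub_zero, sub_zero]
      exact div_pos (lt_of_le_of_ne (noise_nonneg hp e) he.symm) (diffProb_one_pos hF _)).exists
  refine ⟨0, 0, s₀, s₁, ⟨Nat.zero_le _, Nat.zero_le _⟩, fun h => absurd h (lt_irrefl _), ?_, ?_⟩
  · rw [codeRate_uvCode_rsCode hx (Nat.zero_le _) (Nat.zero_le _)]
    simpa using hR.le
  · simpa using maxErrorProb_uvDecode_le hp hs₁ hs₀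

/-! ### All p together, and the main theorem. -/

theorem exists_hasGoodCode {p : ℝ} (hp : p ∈ Set.Icc (0 : ℝ) 1) {R : ℝ}
    (hR : R < ((p + 2) * (p - 1) ^ 2 / (2 - p) + (1 - p) ^ 4) / 2) :
    ∃ b : ℕ → ℝ, Tendsto b atTop (𝓝 0) ∧ ∀ᶠ q : ℕ in atTop, ∀ (F : Type) [Field F] [Fintype F],
      Fintype.card F = q → ∀ x : Fin q → F, Function.Injective x →
        ∃ k₀ k₁ s₀ s₁, HasGoodCode p R (b q) x k₀ k₁ s₀ s₁ := by
  rcases hp.2.lt_or_eq with hp1 | rfl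
  · exact exists_hasGoodCode_of_lt_one hp hp1 hR
  · refine ⟨fun _ => 0, tendsto_const_nhds, ?_⟩
    filter_upwards [eventually_ge_atTop 3] with q hq
    intro F _ _ hF x hx
    exact exists_hasGoodCode_one (by norm_num at hR; exact hR)
      (by rw [hF]; exact_mod_cast hq) (by omega) hx

theorem exists_kvCapacity_channelU_bound {p : ℝ} (hp : p ∈ Set.Icc (0 : ℝ) 1) :
    ∃ K : ℝ, ∀ (F : Type) [Field F] [Fintype F],
      |kvCapacity (channelU (qSC F p)) - (p + 2) * (p - 1) ^ 2 / (2 - p)|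
        ≤ K / (Fintype.card F : ℝ) := by
  set T := (p + 2) * (p - 1) ^ 2 / (2 - p) with hT
  -- The second summand covers the alphabet of size 2, which the estimate for q ≥ 3 leaves out.
  refine ⟨20 + 2 * |capU p 2 - T|, fun F _ _ => ?_⟩
  rw [kvCapacity_channelU, sum_noise_mul_sum_postU_sq, sum_noise_mul_postU]
  have hq : 2 ≤ Fintype.card F := Fintype.one_lt_card
  rcases hq.eq_or_lt with h | h
  · rw [← h, Nat.cast_ofNat, le_div_iff₀ (by norm_num)]
    linarith [abs_nonneg (capU p 2 - T)]
  · have h3 : (3 : ℝ) ≤ Fintype.card F := by exact_mod_cast h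
    refine (abs_capU_sub_le hp h3).trans ?_
    gcongr
    linarith [abs_nonneg (capU p 2 - T)]

theorem mainTheorem7 (p : ℝ) (hp : p ∈ Set.Icc (0 : ℝ) 1) :
    (∃ K : ℝ, ∀ (F : Type) [Field F] [Fintype F],
      |kvCapacity (channelU (qSC F p)) - (p + 2) * (p - 1) ^ 2 / (2 - p)|
        ≤ K / (Fintype.card F : ℝ)) ∧
    (∃ K : ℝ, ∀ (F : Type) [Field F] [Fintype F],
      |kvCapacity (channelV (qSC F p)) - (1 - p) ^ 4| ≤ K / (Fintype.card F : ℝ)) ∧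
    ∀ R : ℝ, R < (p ^ 3 - 4 * p ^ 2 + 4 * p - 4) * (1 - p) ^ 2 / (2 * (p - 2)) →
      ∃ (F : ℕ → Type) (_ : ∀ m, Field (F m)) (_ : ∀ m, Fintype (F m))
        (n k₀ k₁ s₀ s₁ : ℕ → ℕ) (x : ∀ m, Fin (n m) → F m),
        StrictMono (fun m => Fintype.card (F m)) ∧ StrictMono n ∧
        (∀ m, Function.Injective (x m)) ∧
        (∀ m, k₀ m ≤ n m ∧ k₁ m ≤ n m) ∧
        (p < 1 → ∀ m, 1 ≤ k₀ m ∧ 1 ≤ k₁ m) ∧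
        (∀ m, R ≤ codeRate (uvCode (rsCode (x m) (k₀ m)) (rsCode (x m) (k₁ m)))) ∧
        Tendsto (fun m => maxErrorProb (qSC (F m) p)
          (uvCode (rsCode (x m) (k₀ m)) (rsCode (x m) (k₁ m)))
          (uvDecode (qSC (F m) p) (x m) (k₀ m) (k₁ m) (s₀ m) (s₁ m))) atTop (𝓝 0) := by
  refine ⟨exists_kvCapacity_channelU_bound hp, ⟨9, fun F _ _ => ?_⟩, fun R hR => ?_⟩
  · rw [kvCapacity_channelV]
    exact abs_sum_diffProb_sq_sub_le hp
  have hR' : R < ((p + 2) * (p - 1) ^ 2 / (2 - p) + (1 - p) ^ 4) / 2 := by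
    refine hR.trans_eq ?_
    have h1 : p - 2 ≠ 0 := by linarith [hp.2]
    have h2 : 2 - p ≠ 0 := by linarith [hp.2]
    rw [div_add' _ _ _ h2, div_div, div_eq_div_iff (mul_ne_zero two_ne_zero h1)
      (mul_ne_zero h2 two_ne_zero)]
    ring
  obtain ⟨b, hb, hev⟩ := exists_hasGoodCode hp hR'
  obtain ⟨M, hM⟩ := eventually_atTop.1 hev
  -- Prime fields beyond the threshold M suffice; all field elements serve as evaluation points, so
  -- the length equals q.
  let pr : ℕ → ℕ := fun m => Nat.nth Nat.Prime (m + M)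
  have hprime : ∀ m, Fact (pr m).Prime := fun m => ⟨Nat.prime_nth_prime _⟩
  have hmono : StrictMono pr := fun m m' h =>
    Nat.nth_strictMono Nat.infinite_setOfPred_prime (by omega)
  have hle : ∀ m, M ≤ pr m := fun m =>
    (Nat.le_add_left M m).trans ((Nat.nth_strictMono Nat.infinite_setOfPred_prime).le_apply)
  have hcard : ∀ m, Fintype.card (ZMod (pr m)) = pr m := fun m => ZMod.card _
  let x : ∀ m, Fin (pr m) → ZMod (pr m) := fun m => (Fintype.equivFinOfCardEq (hcard m)).symm
  have hx : ∀ m, Function.Injective (x m) := fun m => Equiv.injective _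
  choose k₀ k₁ s₀ s₁ hk hk1 hrate herr using
    fun m => hM (pr m) (hle m) (ZMod (pr m)) (hcard m) (x m) (hx m)
  refine ⟨fun m => ZMod (pr m), fun m => inferInstance, fun m => inferInstance, pr, k₀, k₁, s₀, s₁,
    x, ?_, hmono, hx, hk, fun h m => hk1 m h, hrate, ?_⟩
  · simpa only [hcard] using hmono
  · exact squeeze_zero (fun m => maxErrorProb_nonneg hp _ _) herr (hb.comp hmono.tendsto_atTop)
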